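/- Let $d\ge 1$, $\alpha_i\in(1,2)$ and $d_{i,\pm}\ge 0$ for $1\le i\le d$, and put $$\mu:=\max_{1\le i\le d}\frac{|d_{i,+}-d_{i,-}|}{d_{i,+}+d_{i,-}}\left|\tan\left(\frac{\alpha_i}{2}\pi\right)\right|,$$ where an index with $d_{i,+}=d_{i,-}=0$ contributes $0$. For $a_i<b_i$, a time step $\tau>0$ and $\mathbf n=(n_1,\dots,n_d)$ with $n_i\ge 1$, let $n=n_1\cdots n_d$, $\nu=1/\tau$, $h_i=(b_i-a_i)/(n_i+1)$, $\widetilde v_{i,\pm}=d_{i,\pm}/h_i^{\alpha_i}$, and let $\widetilde L_m^{(\alpha)}\in\mathbb R^{m\times m}$ be the Toeplitz matrix with entries $-\widetilde g^{(\alpha)}_{j-k+1}$, where $\widetilde g^{(\alpha)}_l=(-1)^l\binom{\alpha}{l}$ for $l\ge 0$ and $\widetilde g^{(\alpha)}_l=0$ for $l<0$. Let $$\widetilde A_n=\nu I_n+\sum_{i=1}^d\left(\widetilde v_{i,+}\widetilde W_i+\widetilde v_{i,-}\widetilde W_i^{\top}\right),\qquad \widetilde W_i=I_{n_1\cdots n_{i-1}}\otimes\widetilde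 L_{n_i}^{(\alpha_i)}\otimes I_{n_{i+1}\cdots n_d},$$ $$\widetilde P_n=\nu I_n+\sum_{i=1}^d(\widetilde v_{i,+}+\widetilde v_{i,-})\,I_{n_1\cdots n_{i-1}}\otimes\tau\left(\mathcal H(\widetilde L_{n_i}^{(\alpha_i)})\right)\otimes I_{n_{i+1}\cdots n_d},$$ where $\mathcal H(Z)=(Z+Z^\top)/2$ and, for a symmetric Toeplitz matrix $T$ with first column $(t_1,\dots,t_m)^\top$, $\tau(T)=T-H$ with $H$ the Hankel matrix with first column $(t_3,\dots,t_m,0,0)^\top$ and last column $(0,0,t_m,\dots,t_3)^\top$. Let $Y_n=Y_{n_1}\otimes\cdots\otimes Y_{n_d}$ be the $n\times n$ anti-identity matrix. For a symmetric positive definite matrix $P$ write $\|z\|_P=\sqrt{z^\top P z}$. There is a number $\epsilon$, depending only on the $\alpha_i$ and $d_{i,\pm}$ (in particular independent of $\mathbf n$, $\tau$ and the $a_i,b_i$), with $0<\epsilon<\mu$ if $\mu>0$ and $\epsilon=0$ if $\mu=0$, such that, with $$\omega:=\sqrt{\frac{2+3\epsilon}{4+3\epsilon}}\in\left[\sqrt{1/2},\,1\right)\qquad\left(\omega>\sqrt{1/2}\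 \text{ if }\mu>0\right),$$ the following holds for all $a_i<b_i$, $\tau>0$ and $\mathbf n$. The matrix $\widetilde P_n$ is symmetric positive definite, $Y_n\widetilde A_n$ is symmetric, and all eigenvalues of $\widetilde P_n^{-1}Y_n\widetilde A_n$ lie in $\left(-\frac32(1+\epsilon),-\frac12\right)\cup\left(\frac12,\frac32(1+\epsilon)\right)$. Moreover, for every right-hand side $\mathbf b$, every initial guess $\mathbf u^{(0)}$ and every $k\ge 0$, the $k$-th iterate $\mathbf u^{(k)}$ of MINRES for $Y_n\widetilde A_n\mathbf x=Y_n\mathbf b$ with preconditioner $\widetilde P_n$ exists and is unique, and the preconditioned residuals $\mathbf r^{(k)}=\widetilde P_n^{-1}Y_n\mathbf b-\widetilde P_n^{-1}Y_n\widetilde A_n\mathbf u^{(k)}$ satisfy $$\|\mathbf r^{(k)}\|_{\widetilde P_n}\le 2\,\omega^{k}\,\|\mathbf r^{(0)}\|_{\widetilde P_n}.$$ Here $\mathbf u^{(k)}$ is the minimizer of $\left\|\widetilde P_n^{-1}Y_n\mathbf b-\widetilde P_n^{-1}Y_n\widetilde A_n\mathbf v\right\|_{\widetilde P_n}$ over $\mathbf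 v\in\mathbf u^{(0)}+\mathrm{span}\{B^j\mathbf r^{(0)}:0\le j<k\}$ with $B=\widetilde P_n^{-1}Y_n\widetilde A_n$. Equivalently, $\|\mathbf r^{(k)}\|_{\widetilde P_n}$ is the Euclidean norm of $\widetilde P_n^{-1/2}(Y_n\mathbf b-Y_n\widetilde A_n\mathbf u^{(k)})$, the residual of the symmetrically preconditioned system with matrix $\widetilde P_n^{-1/2}Y_n\widetilde A_n\widetilde P_n^{-1/2}$. -/

import Mathlib

open scoped Matrix

noncomputable section

namespace TauMinres

/-! ### Toeplitz, Tau and multilevel matrices -/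

/-- The coefficient `(-1)^k * binom(α, k) = (-1)^k / k! * α (α - 1) ⋯ (α - k + 1)`. -/
def grunwaldCoeff (α : ℝ) (k : ℕ) : ℝ :=
  (-1) ^ k / (k.factorial : ℝ) * ∏ j ∈ Finset.range k, (α - (j : ℝ))

/-- The lower Hessenberg Toeplitz matrix of the shifted Grünwald scheme: with `g k` the Grünwald
coefficients, its entries are `-g (i - j + 1)`, read as `0` when `i - j + 1 < 0`. -/
def grunwaldMatrix (m : ℕ) (α : ℝ) : Matrix (Fin m) (Fin m) ℝ :=
  Matrix.of fun i j =>
    if (j : ℕ) ≤ (i : ℕ) + 1 then -grunwaldCoeff α ((i : ℕ) + 1 - (j : ℕ)) else 0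

/-- The symmetric part `(Z + Zᵀ) / 2` of a real square matrix. -/
def symmPart {ι : Type*} (Z : Matrix ι ι ℝ) : Matrix ι ι ℝ :=
  (1 / 2 : ℝ) • (Z + Zᵀ)

/-- The `k`-th entry (counted from `0`) of the first column of `T`, and `0` for `k ≥ m`. -/
def firstCol {m : ℕ} (T : Matrix (Fin m) (Fin m) ℝ) (k : ℕ) : ℝ :=
  if h : k < m then T ⟨k, h⟩ ⟨0, Nat.lt_of_le_of_lt (Nat.zero_le k) h⟩ else 0

/-- If `(t₁, …, tₘ)` is the first column of `T`, this is the Hankel matrix with first column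
`(t₃, …, tₘ, 0, 0)` and last column `(0, 0, tₘ, …, t₃)`. With indices counted from `0`, at most one
of the two summands is nonzero. -/
def hankelCorrection {m : ℕ} (T : Matrix (Fin m) (Fin m) ℝ) : Matrix (Fin m) (Fin m) ℝ :=
  Matrix.of fun i j =>
    firstCol T ((i : ℕ) + (j : ℕ) + 2) + firstCol T (2 * m - ((i : ℕ) + (j : ℕ)))

/-- The Tau matrix of a symmetric Toeplitz matrix. -/
def tauMatrix {m : ℕ} (T : Matrix (Fin m) (Fin m) ℝ) : Matrix (Fin m) (Fin m) ℝ :=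
  T - hankelCorrection T

/-- The index set of an `n₁ ⋯ n_d`-dimensional multilevel vector. -/
abbrev Idx {d : ℕ} (n : Fin d → ℕ) : Type := (i : Fin d) → Fin (n i)

/-- The `d`-fold Kronecker product `M₁ ⊗ ⋯ ⊗ M_d`, indexed by multi-indices. -/
def multiKronecker {d : ℕ} {n : Fin d → ℕ} (M : (i : Fin d) → Matrix (Fin (n i)) (Fin (n i)) ℝ) :
    Matrix (Idx n) (Idx n) ℝ :=
  Matrix.of fun p q => ∏ i, M i (p i) (q i)

/-- The matrix `I ⊗ ⋯ ⊗ I ⊗ B ⊗ I ⊗ ⋯ ⊗ I` with `B` in position `i`. -/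
def inDirection {d : ℕ} {n : Fin d → ℕ} (i : Fin d) (B : Matrix (Fin (n i)) (Fin (n i)) ℝ) :
    Matrix (Idx n) (Idx n) ℝ :=
  multiKronecker (Function.update (fun j => (1 : Matrix (Fin (n j)) (Fin (n j)) ℝ)) i B)

/-- The `m × m` anti-identity matrix. -/
def antiIdentity (m : ℕ) : Matrix (Fin m) (Fin m) ℝ :=
  Matrix.of fun j k => if (j : ℕ) + (k : ℕ) + 1 = m then 1 else 0

/-- The multilevel flip `Y = Y_{n₁} ⊗ ⋯ ⊗ Y_{n_d}`. -/
def flipMatrix {d : ℕ} (n : Fin d → ℕ) : Matrix (Idx n) (Idx n) ℝ :=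
  multiKronecker fun i => antiIdentity (n i)

/-! ### The discretized fractional diffusion equation -/

/-- The step size in direction `i` on the box `∏ (a i, b i)` with `n i` interior points. -/
def stepSize {d : ℕ} (a b : Fin d → ℝ) (n : Fin d → ℕ) (i : Fin d) : ℝ :=
  (b i - a i) / ((n i : ℝ) + 1)

/-- The coefficient matrix of the first-order scheme (backward Euler in time with step `τ`,
shifted Grünwald in space), with `dp i`, `dm i` the left and right diffusion coefficients. -/
def coeffMatrix {d : ℕ} (α dp dm a b : Fin d → ℝ) (τ : ℝ) (n : Fin d → ℕ) :
    Matrix (Idx n) (Idx n) ℝ :=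
  (1 / τ) • (1 : Matrix (Idx n) (Idx n) ℝ) +
    ∑ i, ((dp i / stepSize a b n i ^ α i) • inDirection i (grunwaldMatrix (n i) (α i)) +
      (dm i / stepSize a b n i ^ α i) • (inDirection i (grunwaldMatrix (n i) (α i)))ᵀ)

/-- The multilevel Tau preconditioner of the first-order scheme. -/
def tauPreconditioner {d : ℕ} (α dp dm a b : Fin d → ℝ) (τ : ℝ) (n : Fin d → ℕ) :
    Matrix (Idx n) (Idx n) ℝ :=
  (1 / τ) • (1 : Matrix (Idx n) (Idx n) ℝ) +
    ∑ i, (dp i / stepSize a b n i ^ α i + dm i / stepSize a b n i ^ α i) •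
      inDirection i (tauMatrix (symmPart (grunwaldMatrix (n i) (α i))))

/-- The number `max_i |d_{i,+} - d_{i,-}| / (d_{i,+} + d_{i,-}) * |tan (α_i π / 2)|`, an index with
`d_{i,+} = d_{i,-} = 0` contributing `0`. -/
def skewBound {d : ℕ} (α dp dm : Fin d → ℝ) : ℝ :=
  ⨆ i, |dp i - dm i| / (dp i + dm i) * |Real.tan (α i / 2 * Real.pi)|

/-! ### The preconditioned MINRES method -/

section Minres

variable {ι : Type*} [Fintype ι] [DecidableEq ι]

/-- The residual `P⁻¹ c - P⁻¹ M u` of the system `M x = c` preconditioned by `P`. -/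
def precResidual (P M : Matrix ι ι ℝ) (c u : ι → ℝ) : ι → ℝ :=
  P⁻¹ *ᵥ c - (P⁻¹ * M) *ᵥ u

/-- The norm `‖z‖_P = √(zᵀ P z)` of a symmetric positive definite `P`. On `z = P⁻¹ r` it equals
`√(rᵀ P⁻¹ r)`, the Euclidean norm of `P^{-1/2} r`. -/
def precNorm (P : Matrix ι ι ℝ) (z : ι → ℝ) : ℝ :=
  √(z ⬝ᵥ (P *ᵥ z))

/-- The Krylov space spanned by `z, B z, …, B^(k-1) z`. -/
def krylov (B : Matrix ι ι ℝ) (z : ι → ℝ) (k : ℕ) : Submodule ℝ (ι → ℝ) :=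
  Submodule.span ℝ (Set.range fun j : Fin k => (B ^ (j : ℕ)) *ᵥ z)

/-- `u` is the `k`-th iterate of MINRES for `M x = c` (`M` symmetric) with symmetric positive
definite preconditioner `P` and initial guess `u₀`: it minimizes the `P`-norm of the preconditioned
residual over `u₀ + K_k(P⁻¹ M, P⁻¹ c - P⁻¹ M u₀)`. -/
structure IsMinresIterate (P M : Matrix ι ι ℝ) (c u₀ : ι → ℝ) (k : ℕ) (u : ι → ℝ) : Prop where
  mem : u - u₀ ∈ krylov (P⁻¹ * M) (precResidual P M c u₀) k
  minimal : ∀ v : ι → ℝ, v - u₀ ∈ krylov (P⁻¹ * M) (precResidual P M c u₀) k →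
    precNorm P (precResidual P M c u) ≤ precNorm P (precResidual P M c v)

end Minres

end TauMinres

end

/-!
Up to the shift `ν I`, the coefficient matrix `A` and the preconditioner `P` are Kronecker sums, so
that every comparison of quadratic forms reduces to a single direction. There the symmetric Toeplitz
matrix `H(L)` satisfies `1/2 τ(H(L)) ≤ H(L) ≤ 6/5 τ(H(L))`: after subtracting a multiple of the
Hankel correction the matrix remains positive semidefinite by a weighted form of diagonal dominance,
which rests on the decay of the Grünwald coefficients. Hence `1/2 P < H(A) < 6/5 P`.

The skew part is controlled by the symbol `-e^{-iθ} (1 - e^{iθ})^α`, whose argument stays within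
the sector `|Im z| ≤ |tan (α π / 2)| Re z`. Mixing `L` with its transpose narrows the sector by the
factor `|d₊ - d₋| / (d₊ + d₋)`, so `A` lies in the sector of slope `μ`, and such an `A` satisfies
`|xᵀAy| ≤ √(1 + μ²) √(xᵀAx) √(yᵀAy)`.

The flip `Y` commutes with `P`. For an eigenvector `YAv = rPv` this gives `vᵀAv = r (Yv)ᵀPv` and
`r vᵀPv = (Yv)ᵀAv`, hence `1/2 < |r| < 6/5 (1 + ε)` with `ε = √(1 + μ²) - 1`. The residual bound is
then the one for Chebyshev polynomials in `r²`; for odd `k` these lose one degree, which the gap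
between `6/5` and `3/2` makes up for.
-/

noncomputable section

namespace TauMinres

/-! ### Quadratic forms of real matrices -/

section

variable {ι : Type*}

theorem symmPart_isSymm (Z : Matrix ι ι ℝ) : (symmPart Z).IsSymm := by
  rw [Matrix.IsSymm, symmPart, Matrix.transpose_smul, Matrix.transpose_add,
    Matrix.transpose_transpose, add_comm]

theorem symmPart_add (A B : Matrix ι ι ℝ) : symmPart (A + B) = symmPart A + symmPart B := by
  simp only [symmPart, Matrix.transpose_add, smul_add]
  abel

theorem symmPart_smul (c : ℝ) (A : Matrix ι ι ℝ) : symmPart (c • A) = c • symmPart A := by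
  rw [symmPart, symmPart, Matrix.transpose_smul, ← smul_add, smul_comm]

theorem symmPart_transpose (A : Matrix ι ι ℝ) : symmPart Aᵀ = symmPart A := by
  rw [symmPart, symmPart, Matrix.transpose_transpose, add_comm]

variable [Fintype ι]

theorem dotProduct_symmPart_mulVec (A : Matrix ι ι ℝ) (x y : ι → ℝ) :
    x ⬝ᵥ symmPart A *ᵥ y = (x ⬝ᵥ A *ᵥ y + y ⬝ᵥ A *ᵥ x) / 2 := by
  rw [symmPart, Matrix.smul_mulVec, Matrix.add_mulVec, dotProduct_smul, dotProduct_add,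
    Matrix.dotProduct_transpose_mulVec, smul_eq_mul]
  ring

theorem dotProduct_symmPart_mulVec_self (A : Matrix ι ι ℝ) (x : ι → ℝ) :
    x ⬝ᵥ symmPart A *ᵥ x = x ⬝ᵥ A *ᵥ x := by
  rw [dotProduct_symmPart_mulVec]
  ring

theorem dotProduct_mulVec_comm {M : Matrix ι ι ℝ} (hM : M.IsSymm) (x y : ι → ℝ) :
    x ⬝ᵥ M *ᵥ y = y ⬝ᵥ M *ᵥ x := by
  rw [← Matrix.dotProduct_transpose_mulVec, hM.eq]

theorem posSemidef_iff_isSymm_and_nonneg {M : Matrix ι ι ℝ} :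
    M.PosSemidef ↔ M.IsSymm ∧ ∀ x, 0 ≤ x ⬝ᵥ M *ᵥ x := by
  rw [Matrix.posSemidef_iff_dotProduct_mulVec, Matrix.isHermitian_iff_isSymm]
  simp only [star_trivial]

theorem sq_dotProduct_mulVec_le {M : Matrix ι ι ℝ} (hM : M.PosSemidef) (x y : ι → ℝ) :
    (x ⬝ᵥ M *ᵥ y) ^ 2 ≤ (x ⬝ᵥ M *ᵥ x) * (y ⬝ᵥ M *ᵥ y) := by
  classical
  obtain ⟨hsymm, hnonneg⟩ := posSemidef_iff_isSymm_and_nonneg.1 hM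
  simpa only [Matrix.toLinearMap₂'_apply'] using
    LinearMap.BilinForm.apply_sq_le_of_symm (Matrix.toLinearMap₂' ℝ M)
      (fun z => by simpa only [Matrix.toLinearMap₂'_apply'] using hnonneg z)
      ⟨fun z w => by
        simpa only [Matrix.toLinearMap₂'_apply', RingHom.id_apply] using
          dotProduct_mulVec_comm hsymm z w⟩ x y

theorem quadratic_nonneg_of_sq_le_mul {p q m : ℝ} (hp : 0 ≤ p) (hq : 0 ≤ q) (hm : m ^ 2 ≤ p * q)
    (x y : ℝ) : 0 ≤ p * x ^ 2 + 2 * (m * x * y) + q * y ^ 2 := by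
  have hsq : (m * x * y) ^ 2 ≤ ((p * x ^ 2 + q * y ^ 2) / 2) ^ 2 := by
    have h := mul_le_mul_of_nonneg_right hm (by positivity : 0 ≤ x ^ 2 * y ^ 2)
    nlinarith [sq_nonneg (p * x ^ 2 - q * y ^ 2)]
  linarith [(abs_le_of_sq_le_sq' hsq (by positivity)).1]

theorem posSemidef_of_dominance_weights [DecidableEq ι] {M : Matrix ι ι ℝ} (hM : M.IsSymm)
    (c : ι → ι → ℝ) (hc : ∀ i j, i ≠ j → 0 ≤ c i j)
    (hsq : ∀ i j, i ≠ j → M i j ^ 2 ≤ c i j * c j i)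
    (hrow : ∀ i, ∑ j ∈ Finset.univ.erase i, c i j ≤ M i i) : M.PosSemidef := by
  refine posSemidef_iff_isSymm_and_nonneg.2 ⟨hM, fun x => ?_⟩
  have hpair : ∀ i j, i ≠ j →
      -(c i j * x i ^ 2 + c j i * x j ^ 2) ≤ 2 * (x i * (M i j * x j)) := fun i j hij => by
    have hform := quadratic_nonneg_of_sq_le_mul (hc i j hij) (hc j i hij.symm) (hsq i j hij)
    linarith [hform (x i) (x j)]
  have hswap : ∑ i, ∑ j ∈ Finset.univ.erase i, c j i * x j ^ 2 =
      ∑ i, ∑ j ∈ Finset.univ.erase i, c i j * x i ^ 2 :=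
    Finset.sum_comm' fun i j => by simp [ne_comm]
  have hsum : ∑ i, (2 * M i i * x i ^ 2 -
      ∑ j ∈ Finset.univ.erase i, (c i j * x i ^ 2 + c j i * x j ^ 2)) ≤ 2 * (x ⬝ᵥ M *ᵥ x) := by
    simp only [dotProduct, Matrix.mulVec, Finset.mul_sum]
    refine Finset.sum_le_sum fun i _ => ?_
    rw [← Finset.add_sum_erase _ _ (Finset.mem_univ i), sub_eq_add_neg, ← Finset.sum_neg_distrib]
    refine add_le_add (le_of_eq (by ring)) (Finset.sum_le_sum fun j hj => ?_)
    exact hpair i j (Finset.ne_of_mem_erase hj).symm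
  have hdiag : ∑ i, ∑ j ∈ Finset.univ.erase i, c i j * x i ^ 2 ≤ ∑ i, M i i * x i ^ 2 :=
    Finset.sum_le_sum fun i _ => by
      rw [← Finset.sum_mul]
      exact mul_le_mul_of_nonneg_right (hrow i) (sq_nonneg _)
  simp only [Finset.sum_sub_distrib, Finset.sum_add_distrib, hswap, mul_assoc,
    ← Finset.mul_sum] at hsum
  linarith

/-! ### Sectorial matrices -/

/-- The numerical range of `A` over `ℂ` lies in the sector `|Im z| ≤ μ Re z`. This is written with
real vectors only: at `x + i y` the complex quadratic form has the real part `xᵀAx + yᵀAy` and the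
imaginary part `xᵀAy - yᵀAx`. -/
def IsSectorial (μ : ℝ) (A : Matrix ι ι ℝ) : Prop :=
  ∀ x y : ι → ℝ, |x ⬝ᵥ A *ᵥ y - y ⬝ᵥ A *ᵥ x| ≤ μ * (x ⬝ᵥ A *ᵥ x + y ⬝ᵥ A *ᵥ y)

namespace IsSectorial

variable {μ : ℝ} {A B : Matrix ι ι ℝ}

protected theorem zero (μ : ℝ) : IsSectorial μ (0 : Matrix ι ι ℝ) := fun x y => by
  simp only [Matrix.zero_mulVec, dotProduct_zero, sub_zero, abs_zero, add_zero, mul_zero, le_refl]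

protected theorem one [DecidableEq ι] (hμ : 0 ≤ μ) : IsSectorial μ (1 : Matrix ι ι ℝ) :=
  fun x y => by
    have hnonneg := (posSemidef_iff_isSymm_and_nonneg.1 (Matrix.PosSemidef.one (n := ι) (R := ℝ))).2
    rw [dotProduct_mulVec_comm Matrix.isSymm_one, sub_self, abs_zero]
    exact mul_nonneg hμ (add_nonneg (hnonneg x) (hnonneg y))

protected theorem add (hA : IsSectorial μ A) (hB : IsSectorial μ B) : IsSectorial μ (A + B) :=
  fun x y => by
    have h := (abs_add_le _ _).trans (add_le_add (hA x y) (hB x y))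
    simp only [Matrix.add_mulVec, dotProduct_add]
    rw [add_sub_add_comm]
    linarith

protected theorem sum {κ : Type*} {s : Finset κ} {M : κ → Matrix ι ι ℝ}
    (h : ∀ i ∈ s, IsSectorial μ (M i)) : IsSectorial μ (∑ i ∈ s, M i) :=
  Finset.sum_induction M (IsSectorial μ) (fun _ _ => IsSectorial.add) (IsSectorial.zero μ) h

theorem smul_add_smul_transpose {t p q : ℝ} (hA : IsSectorial t A)
    (hpos : (symmPart A).PosSemidef) (hpq : |p - q| * t ≤ μ * (p + q)) :
    IsSectorial μ (p • A + q • Aᵀ) := fun x y => by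
  have hnonneg := (posSemidef_iff_isSymm_and_nonneg.1 hpos).2
  simp only [dotProduct_symmPart_mulVec_self] at hnonneg
  have hform := mul_le_mul_of_nonneg_right hpq (add_nonneg (hnonneg x) (hnonneg y))
  have hskew := mul_le_mul_of_nonneg_left (hA x y) (abs_nonneg (p - q))
  simp only [Matrix.add_mulVec, Matrix.smul_mulVec, dotProduct_add, dotProduct_smul,
    Matrix.dotProduct_transpose_mulVec, smul_eq_mul]
  calc _ = |p - q| * |x ⬝ᵥ A *ᵥ y - y ⬝ᵥ A *ᵥ x| := by
        rw [← abs_mul]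
        ring_nf
    _ ≤ _ := by linarith

protected theorem smul (hA : IsSectorial μ A) {c : ℝ} (hc : 0 ≤ c) : IsSectorial μ (c • A) :=
  fun x y => by
    simp only [Matrix.smul_mulVec, dotProduct_smul, smul_eq_mul, ← mul_sub, ← mul_add, abs_mul,
      abs_of_nonneg hc, mul_left_comm μ c]
    exact mul_le_mul_of_nonneg_left (hA x y) hc

theorem sq_skew_le (hA : IsSectorial μ A) (x y : ι → ℝ) :
    (x ⬝ᵥ A *ᵥ y - y ⬝ᵥ A *ᵥ x) ^ 2 ≤ 4 * μ ^ 2 * ((x ⬝ᵥ A *ᵥ x) * (y ⬝ᵥ A *ᵥ y)) := by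
  have hquad : ∀ s : ℝ, 0 ≤ μ * (x ⬝ᵥ A *ᵥ x) * (s * s) +
      (x ⬝ᵥ A *ᵥ y - y ⬝ᵥ A *ᵥ x) * s + μ * (y ⬝ᵥ A *ᵥ y) := fun s => by
    have h := (abs_le.1 (hA (s • x) y)).1
    simp only [Matrix.mulVec_smul, dotProduct_smul, smul_dotProduct, smul_eq_mul] at h
    linarith
  have h := discrim_le_zero hquad
  rw [discrim] at h
  linarith

/-- With `H` and `S` the symmetric and the skew part of `A` and `w = H⁻¹ S y`, the form `xᵀAy` is
`xᵀH(y + w)`; since `yᵀHw = yᵀSy = 0`, the vector `y + w` has squared `H`-norm `yᵀHy + wᵀHw`, and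
`wᵀHw = wᵀSy` is at most `μ² yᵀHy`. -/
theorem sq_dotProduct_mulVec_le (hA : IsSectorial μ A) (hpos : (symmPart A).PosDef)
    (x y : ι → ℝ) :
    (x ⬝ᵥ A *ᵥ y) ^ 2 ≤ (1 + μ ^ 2) * ((x ⬝ᵥ A *ᵥ x) * (y ⬝ᵥ A *ᵥ y)) := by
  classical
  obtain ⟨w, hw⟩ : ∃ w, symmPart A *ᵥ w = A *ᵥ y - symmPart A *ᵥ y :=
    ⟨(symmPart A)⁻¹ *ᵥ (A *ᵥ y - symmPart A *ᵥ y), by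
      rw [Matrix.mulVec_mulVec, Matrix.mul_nonsing_inv _ (hpos.isUnit.map Matrix.detMonoidHom),
        Matrix.one_mulVec]⟩
  have hskew : ∀ z, z ⬝ᵥ symmPart A *ᵥ w = (z ⬝ᵥ A *ᵥ y - y ⬝ᵥ A *ᵥ z) / 2 := fun z => by
    rw [hw, dotProduct_sub, dotProduct_symmPart_mulVec]
    ring
  obtain ⟨hsymm, hnonneg⟩ := posSemidef_iff_isSymm_and_nonneg.1 hpos.posSemidef
  have hxx := dotProduct_symmPart_mulVec_self A x
  have hyy := dotProduct_symmPart_mulVec_self A y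
  have hyw : y ⬝ᵥ symmPart A *ᵥ w = 0 := by
    rw [hskew]
    ring
  have hww : w ⬝ᵥ symmPart A *ᵥ w ≤ μ ^ 2 * (y ⬝ᵥ A *ᵥ y) := by
    have h := hA.sq_skew_le w y
    rw [← dotProduct_symmPart_mulVec_self A w] at h
    have h2 := hskew w
    rcases (hnonneg w).eq_or_lt with h0 | h0
    · rw [← h0, ← hyy]
      exact mul_nonneg (sq_nonneg μ) (hnonneg y)
    · refine le_of_mul_le_mul_left ?_ h0
      nlinarith
  have hyw' : (y + w) ⬝ᵥ symmPart A *ᵥ (y + w) ≤ (1 + μ ^ 2) * (y ⬝ᵥ A *ᵥ y) := by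
    rw [Matrix.mulVec_add, add_dotProduct, dotProduct_add, dotProduct_add,
      dotProduct_mulVec_comm hsymm w y, hyw]
    linarith
  calc (x ⬝ᵥ A *ᵥ y) ^ 2 = (x ⬝ᵥ symmPart A *ᵥ (y + w)) ^ 2 := by
        rw [Matrix.mulVec_add, hw, add_sub_cancel]
    _ ≤ (x ⬝ᵥ symmPart A *ᵥ x) * ((y + w) ⬝ᵥ symmPart A *ᵥ (y + w)) :=
        TauMinres.sq_dotProduct_mulVec_le hpos.posSemidef _ _
    _ ≤ (x ⬝ᵥ A *ᵥ x) * ((1 + μ ^ 2) * (y ⬝ᵥ A *ᵥ y)) := by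
        rw [hxx]
        exact mul_le_mul_of_nonneg_left hyw' (hxx ▸ hnonneg x)
    _ = _ := by ring

end IsSectorial

end

/-! ### Symmetric definite pencils -/

section

variable {ι : Type*} [Fintype ι] [DecidableEq ι] {P M : Matrix ι ι ℝ}

/-- The number `r` is an eigenvalue of the pencil `(M, P)`, equivalently of `P⁻¹ M` when `P` is
invertible. -/
def IsPencilEigenvalue (M P : Matrix ι ι ℝ) (r : ℝ) : Prop :=
  ∃ v : ι → ℝ, v ≠ 0 ∧ M *ᵥ v = r • P *ᵥ v

theorem exists_isUnit_eq_transpose_mul_self (hP : P.PosDef) : ∃ Q, IsUnit Q ∧ P = Qᵀ * Q := by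
  open scoped MatrixOrder Matrix.Norms.L2Operator in
  exact CStarAlgebra.isStrictlyPositive_iff_eq_star_mul_self.1 hP.isStrictlyPositive

theorem exists_orthogonal_diagonalization (hM : M.IsSymm) :
    ∃ (U : Matrix ι ι ℝ) (l : ι → ℝ), Uᵀ * U = 1 ∧ M * U = U * Matrix.diagonal l := by
  have hherm := Matrix.isHermitian_iff_isSymm.2 hM
  have hU := Unitary.coe_star_mul_self hherm.eigenvectorUnitary
  have hspec := congrArg (· * (hherm.eigenvectorUnitary : Matrix ι ι ℝ)) hherm.spectral_theorem
  simp only [Unitary.conjStarAlgAut_apply, mul_assoc, hU, mul_one] at hspec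
  exact ⟨hherm.eigenvectorUnitary, hherm.eigenvalues, hU, hspec⟩

/-- If `P = QᵀQ`, it suffices to diagonalize the symmetric matrix `Q⁻ᵀ M Q⁻¹` orthogonally. -/
theorem exists_simultaneous_diagonalization (hP : P.PosDef) (hM : M.IsSymm) :
    ∃ (V : Matrix ι ι ℝ) (l : ι → ℝ), Vᵀ * P * V = 1 ∧ M * V = P * V * Matrix.diagonal l := by
  obtain ⟨Q, hQ, rfl⟩ := exists_isUnit_eq_transpose_mul_self hP
  obtain ⟨R, hQR, hRQ⟩ : ∃ R, Q * R = 1 ∧ R * Q = 1 := isUnit_iff_exists.1 hQ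
  have hQRt : Qᵀ * Rᵀ = 1 := by rw [← Matrix.transpose_mul, hRQ, Matrix.transpose_one]
  have hsymm : (Rᵀ * M * R).IsSymm := by
    rw [Matrix.IsSymm, Matrix.transpose_mul, Matrix.transpose_mul, Matrix.transpose_transpose,
      hM.eq, mul_assoc]
  obtain ⟨U, l, hU, hUl⟩ := exists_orthogonal_diagonalization hsymm
  have hQRU : Q * (R * U) = U := by rw [← mul_assoc, hQR, one_mul]
  refine ⟨R * U, l, ?_, ?_⟩
  · rw [mul_assoc, mul_assoc, hQRU, ← mul_assoc, ← Matrix.transpose_mul, hQRU, hU]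
  · calc M * (R * U) = Qᵀ * (Rᵀ * M * R * U) := by
          simp only [← mul_assoc, hQRt, one_mul]
      _ = Qᵀ * Q * (R * U) * Matrix.diagonal l := by
          rw [hUl, mul_assoc Qᵀ, hQRU, mul_assoc]

theorem inv_mul_mul_eq_mul_diagonal (hP : P.PosDef) {V : Matrix ι ι ℝ} {l : ι → ℝ}
    (hM : M * V = P * V * Matrix.diagonal l) : P⁻¹ * M * V = V * Matrix.diagonal l := by
  rw [mul_assoc, hM, mul_assoc, Matrix.nonsing_inv_mul_cancel_left]
  exact hP.isUnit.map Matrix.detMonoidHom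

theorem isPencilEigenvalue_of_diagonalization {V : Matrix ι ι ℝ} {l : ι → ℝ} (hV : IsUnit V)
    (hM : M * V = P * V * Matrix.diagonal l) (i : ι) : IsPencilEigenvalue M P (l i) := by
  refine ⟨V *ᵥ Pi.single i 1, fun h => ?_, ?_⟩
  · have h0 := Matrix.mulVec_injective_of_isUnit hV (h.trans (Matrix.mulVec_zero V).symm)
    simpa using congrFun h0 i
  · rw [Matrix.mulVec_mulVec, hM, Matrix.mulVec_mulVec, ← Matrix.mulVec_mulVec,
      Matrix.diagonal_mulVec_single, mul_one, ← Matrix.mulVec_smul, ← Pi.single_smul, smul_eq_mul,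
      mul_one]

theorem spectrum_inv_mul_subset (hP : P.PosDef) (hM : M.IsSymm) :
    spectrum ℂ ((P⁻¹ * M).map (algebraMap ℝ ℂ)) ⊆
      (fun r : ℝ => (r : ℂ)) '' {r | IsPencilEigenvalue M P r} := by
  obtain ⟨V, l, hVP, hMV⟩ := exists_simultaneous_diagonalization hP hM
  obtain ⟨u, rfl⟩ : IsUnit V := IsUnit.of_mul_eq_one_right _ hVP
  have hconj : P⁻¹ * M = (u * Matrix.diagonal l * (u⁻¹ : (Matrix ι ι ℝ)ˣ) : Matrix ι ι ℝ) := by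
    rw [Units.eq_mul_inv_iff_mul_eq, inv_mul_mul_eq_mul_diagonal hP hMV]
  let w : (Matrix ι ι ℂ)ˣ := Units.map (algebraMap ℝ ℂ).mapMatrix.toMonoidHom u
  have hmap : (P⁻¹ * M).map (algebraMap ℝ ℂ) =
      (w * Matrix.diagonal (algebraMap ℝ ℂ ∘ l) * (w⁻¹ : (Matrix ι ι ℂ)ˣ) : Matrix ι ι ℂ) := by
    rw [hconj, Matrix.map_mul, Matrix.map_mul, Matrix.diagonal_map (map_zero _)]
    rfl
  rw [hmap, spectrum.units_conjugate, spectrum_diagonal]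
  rintro _ ⟨i, rfl⟩
  exact ⟨l i, isPencilEigenvalue_of_diagonalization u.isUnit hMV i, rfl⟩

theorem spectrum_inv_mul_subset_of_abs_mem_Ioo {l u : ℝ} (hP : P.PosDef) (hM : M.IsSymm)
    (hr : ∀ r, IsPencilEigenvalue M P r → |r| ∈ Set.Ioo l u) :
    spectrum ℂ ((P⁻¹ * M).map (algebraMap ℝ ℂ)) ⊆
      (fun r : ℝ => (r : ℂ)) '' (Set.Ioo (-u) (-l) ∪ Set.Ioo l u) := by
  refine (spectrum_inv_mul_subset hP hM).trans (Set.image_mono fun r h => ?_)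
  obtain ⟨hlow, hup⟩ := hr r h
  obtain ⟨hneg, hpos⟩ := abs_lt.1 hup
  exact (lt_abs.1 hlow).elim (fun h => .inr ⟨h, hpos⟩) fun h => .inl ⟨hneg, lt_neg_of_lt_neg h⟩

theorem aeval_mul_eq_mul_aeval {R A : Type*} [CommSemiring R] [Semiring A] [Algebra R A]
    {a v b : A} (h : a * v = v * b) (p : Polynomial R) :
    Polynomial.aeval a p * v = v * Polynomial.aeval b p := by
  induction p using Polynomial.induction_on' with
  | add p q hp hq => rw [map_add, map_add, add_mul, mul_add, hp, hq]
  | monomial k c =>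
    have hpow : a ^ k * v = v * b ^ k := ((show SemiconjBy v b a from h.symm).pow_right k).eq.symm
    rw [Polynomial.aeval_monomial, Polynomial.aeval_monomial, mul_assoc, hpow, ← mul_assoc,
      ← mul_assoc, Algebra.commutes]

theorem aeval_diagonal (l : ι → ℝ) (p : Polynomial ℝ) :
    Polynomial.aeval (Matrix.diagonal l) p = Matrix.diagonal fun i => p.eval (l i) := by
  have h := Polynomial.aeval_algHom_apply (Matrix.diagonalAlgHom ℝ) l p
  rw [Matrix.diagonalAlgHom_apply, Matrix.diagonalAlgHom_apply] at h
  rw [h]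
  congr 1
  ext i
  rw [← Polynomial.coe_aeval_eq_eval]
  exact (Polynomial.aeval_algHom_apply (Pi.evalAlgHom ℝ (fun _ : ι => ℝ) i) l p).symm

theorem precNorm_mulVec {V : Matrix ι ι ℝ} (hVP : Vᵀ * P * V = 1) (y : ι → ℝ) :
    precNorm P (V *ᵥ y) = √(∑ i, y i ^ 2) := by
  rw [precNorm, ← Matrix.vecMul_transpose, ← Matrix.dotProduct_mulVec, Matrix.vecMul_transpose,
    Matrix.mulVec_mulVec, Matrix.mulVec_mulVec, hVP, Matrix.one_mulVec, dotProduct]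
  simp only [pow_two]

theorem precNorm_aeval_mulVec_le (hP : P.PosDef) (hM : M.IsSymm) {p : Polynomial ℝ} {η : ℝ}
    (hη : 0 ≤ η) (hp : ∀ r, IsPencilEigenvalue M P r → |p.eval r| ≤ η) (z : ι → ℝ) :
    precNorm P (Polynomial.aeval (P⁻¹ * M) p *ᵥ z) ≤ η * precNorm P z := by
  obtain ⟨V, l, hVP, hMV⟩ := exists_simultaneous_diagonalization hP hM
  have hV : IsUnit V := IsUnit.of_mul_eq_one_right _ hVP
  obtain ⟨y, rfl⟩ := Matrix.mulVec_surjective_iff_isUnit.2 hV z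
  rw [Matrix.mulVec_mulVec, aeval_mul_eq_mul_aeval (inv_mul_mul_eq_mul_diagonal hP hMV),
    aeval_diagonal, ← Matrix.mulVec_mulVec, precNorm_mulVec hVP, precNorm_mulVec hVP,
    ← Real.sqrt_sq hη, ← Real.sqrt_mul (sq_nonneg η), Finset.mul_sum]
  refine Real.sqrt_le_sqrt (Finset.sum_le_sum fun i _ => ?_)
  rw [Matrix.mulVec_diagonal, mul_pow]
  have hi := hp _ (isPencilEigenvalue_of_diagonalization hV hMV i)
  exact mul_le_mul_of_nonneg_right (sq_le_sq.2 (hi.trans (le_abs_self η))) (sq_nonneg _)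

end

/-! ### Eigenvalues of a flipped pencil -/

section

variable {ι : Type*} [Fintype ι] {A P Y M N : Matrix ι ι ℝ} {l u μ r : ℝ}

theorem dotProduct_mulVec_lt_of_posDef_sub (h : (N - M).PosDef) {v : ι → ℝ} (hv : v ≠ 0) :
    v ⬝ᵥ M *ᵥ v < v ⬝ᵥ N *ᵥ v := by
  have hpos := h.dotProduct_mulVec_pos hv
  rwa [star_trivial, Matrix.sub_mulVec, dotProduct_sub, sub_pos] at hpos

theorem mulVec_dotProduct_of_isSymm (hY : Y.IsSymm) (v w : ι → ℝ) :
    (Y *ᵥ v) ⬝ᵥ w = v ⬝ᵥ Y *ᵥ w := by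
  rw [dotProduct_comm, dotProduct_mulVec_comm hY]

theorem mulVec_dotProduct_mulVec_mulVec (hY : Y.IsSymm) (hYPY : Y * P * Y = P) (v : ι → ℝ) :
    (Y *ᵥ v) ⬝ᵥ P *ᵥ (Y *ᵥ v) = v ⬝ᵥ P *ᵥ v := by
  rw [mulVec_dotProduct_of_isSymm hY, Matrix.mulVec_mulVec, Matrix.mulVec_mulVec, hYPY]

variable [DecidableEq ι]

/-- An eigenvector `v` satisfies `vᵀ A v = r (Y v)ᵀ P v`, and `Y` is an isometry for `P`. -/
theorem IsPencilEigenvalue.lt_abs_of_flip (hP : P.PosDef) (hY : Y.IsSymm) (hYY : Y * Y = 1)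
    (hYPY : Y * P * Y = P) (hlow : (symmPart A - l • P).PosDef)
    (hr : IsPencilEigenvalue (Y * A) P r) : l < |r| := by
  obtain ⟨v, hv, hvr⟩ := hr
  have hPv : 0 < v ⬝ᵥ P *ᵥ v := hP.dotProduct_mulVec_pos hv
  have hAv : v ⬝ᵥ A *ᵥ v = r * ((Y *ᵥ v) ⬝ᵥ P *ᵥ v) := by
    rw [← smul_eq_mul, ← dotProduct_smul, ← hvr, mulVec_dotProduct_of_isSymm hY,
      Matrix.mulVec_mulVec, ← mul_assoc, hYY, one_mul]
  have hcs : |(Y *ᵥ v) ⬝ᵥ P *ᵥ v| ≤ v ⬝ᵥ P *ᵥ v := by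
    refine abs_le_of_sq_le_sq ?_ hPv.le
    have h := sq_dotProduct_mulVec_le hP.posSemidef (Y *ᵥ v) v
    rwa [mulVec_dotProduct_mulVec_mulVec hY hYPY, ← pow_two] at h
  refine lt_of_mul_lt_mul_right ?_ hPv.le
  calc l * (v ⬝ᵥ P *ᵥ v) < v ⬝ᵥ A *ᵥ v := by
        have h := dotProduct_mulVec_lt_of_posDef_sub hlow hv
        rwa [Matrix.smul_mulVec, dotProduct_smul, dotProduct_symmPart_mulVec_self] at h
    _ ≤ |r| * |(Y *ᵥ v) ⬝ᵥ P *ᵥ v| := by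
        rw [hAv, ← abs_mul]
        exact le_abs_self _
    _ ≤ |r| * (v ⬝ᵥ P *ᵥ v) := mul_le_mul_of_nonneg_left hcs (abs_nonneg r)

/-- An eigenvector `v` satisfies `r vᵀ P v = (Y v)ᵀ A v`, which sectoriality of `A` bounds. -/
theorem IsPencilEigenvalue.abs_lt_of_flip (hP : P.PosDef) (hY : Y.IsSymm) (hYY : Y * Y = 1)
    (hYPY : Y * P * Y = P) (hA : (symmPart A).PosDef) (hup : (u • P - symmPart A).PosDef)
    (hsec : IsSectorial μ A) (hr : IsPencilEigenvalue (Y * A) P r) :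
    |r| < u * √(1 + μ ^ 2) := by
  obtain ⟨v, hv, hvr⟩ := hr
  have hYv : Y *ᵥ v ≠ 0 := fun h => hv <| by
    rw [← Matrix.one_mulVec v, ← hYY, ← Matrix.mulVec_mulVec, h, Matrix.mulVec_zero]
  have hPv : 0 < v ⬝ᵥ P *ᵥ v := hP.dotProduct_mulVec_pos hv
  have hApos : ∀ w, w ≠ 0 → 0 < w ⬝ᵥ A *ᵥ w := fun w hw => by
    rw [← dotProduct_symmPart_mulVec_self]
    exact hA.dotProduct_mulVec_pos hw
  have hAle : ∀ w, w ≠ 0 → w ⬝ᵥ A *ᵥ w < u * (w ⬝ᵥ P *ᵥ w) := fun w hw => by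
    have h := dotProduct_mulVec_lt_of_posDef_sub hup hw
    rwa [Matrix.smul_mulVec, dotProduct_smul, dotProduct_symmPart_mulVec_self] at h
  have hu : 0 < u := pos_of_mul_pos_left ((hApos v hv).trans (hAle v hv)) hPv.le
  have hrv : (Y *ᵥ v) ⬝ᵥ A *ᵥ v = r * (v ⬝ᵥ P *ᵥ v) := by
    rw [mulVec_dotProduct_of_isSymm hY, Matrix.mulVec_mulVec, hvr, dotProduct_smul, smul_eq_mul]
  have hsq : (r * (v ⬝ᵥ P *ᵥ v)) ^ 2 < (u * √(1 + μ ^ 2) * (v ⬝ᵥ P *ᵥ v)) ^ 2 := by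
    calc (r * (v ⬝ᵥ P *ᵥ v)) ^ 2
        ≤ (1 + μ ^ 2) * (((Y *ᵥ v) ⬝ᵥ A *ᵥ (Y *ᵥ v)) * (v ⬝ᵥ A *ᵥ v)) := by
          rw [← hrv]
          exact hsec.sq_dotProduct_mulVec_le hA _ _
      _ < (1 + μ ^ 2) * ((u * (v ⬝ᵥ P *ᵥ v)) * (u * (v ⬝ᵥ P *ᵥ v))) := by
          refine mul_lt_mul_of_pos_left ?_ (by positivity)
          refine mul_lt_mul'' ?_ (hAle v hv) (hApos _ hYv).le (hApos v hv).le
          rw [← mulVec_dotProduct_mulVec_mulVec hY hYPY]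
          exact hAle _ hYv
      _ = (u * √(1 + μ ^ 2) * (v ⬝ᵥ P *ᵥ v)) ^ 2 := by
          rw [mul_pow, mul_pow, Real.sq_sqrt (by positivity)]
          ring
  have habs := abs_lt_of_sq_lt_sq hsq (by positivity)
  rw [abs_mul, abs_of_pos hPv] at habs
  exact lt_of_mul_lt_mul_right habs hPv.le

end

/-! ### Chebyshev polynomials on two symmetric intervals -/

section

open Polynomial (Chebyshev.T)

theorem eval_chebyshevT_half_add_inv {z : ℝ} (hz : 0 < z) (n : ℕ) :
    (Chebyshev.T ℝ n).eval ((z + z⁻¹) / 2) = (z ^ n + (z ^ n)⁻¹) / 2 := by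
  rw [← Real.cosh_log hz, Polynomial.Chebyshev.T_real_cosh, ← Real.cosh_log (pow_pos hz n),
    Real.log_pow]
  norm_cast

variable {a b : ℝ}

theorem eval_chebyshevT_of_intervals (ha : 0 < a) (hab : a < b) (j : ℕ) :
    (Chebyshev.T ℝ j).eval ((b ^ 2 + a ^ 2) / (b ^ 2 - a ^ 2)) =
      (1 + (((b - a) / (b + a)) ^ j) ^ 2) / (2 * ((b - a) / (b + a)) ^ j) := by
  have hsub : 0 < b - a := sub_pos.2 hab
  have hadd : 0 < b + a := by linarith
  have harg : (b ^ 2 + a ^ 2) / (b ^ 2 - a ^ 2) =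
      ((b - a) / (b + a) + ((b - a) / (b + a))⁻¹) / 2 := by
    rw [sq_sub_sq]
    field_simp
    ring
  rw [harg, eval_chebyshevT_half_add_inv (div_pos hsub hadd)]
  field_simp
  ring

/-- The extremal polynomial for two symmetric intervals is a Chebyshev polynomial in `r²`. -/
theorem exists_polynomial_abs_eval_le (ha : 0 < a) (hab : a < b) (j : ℕ) :
    ∃ p : Polynomial ℝ, p.natDegree ≤ 2 * j ∧ p.eval 0 = 1 ∧ ∀ r : ℝ, a ≤ |r| → |r| ≤ b →
      |p.eval r| ≤ ((Chebyshev.T ℝ j).eval ((b ^ 2 + a ^ 2) / (b ^ 2 - a ^ 2)))⁻¹ := by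
  have hpos : 0 < b ^ 2 - a ^ 2 := by nlinarith
  set x₀ := (b ^ 2 + a ^ 2) / (b ^ 2 - a ^ 2) with hx₀
  have ht : 0 < (Chebyshev.T ℝ j).eval x₀ := by
    rw [hx₀, eval_chebyshevT_of_intervals ha hab]
    have : 0 < (b - a) / (b + a) := div_pos (sub_pos.2 hab) (by linarith)
    positivity
  set t := (Chebyshev.T ℝ j).eval x₀ with htdef
  refine ⟨.C t⁻¹ * (Chebyshev.T ℝ j).comp (.C x₀ - .C (2 / (b ^ 2 - a ^ 2)) * .X ^ 2), ?_, ?_,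
    fun r har hrb => ?_⟩
  · refine (Polynomial.natDegree_C_mul_le _ _).trans (Polynomial.natDegree_comp_le.trans ?_)
    rw [Polynomial.Chebyshev.natDegree_T, Int.natAbs_natCast, mul_comm]
    refine Nat.mul_le_mul_right _ ((Polynomial.natDegree_sub_le _ _).trans (max_le ?_ ?_))
    · exact (Polynomial.natDegree_C _).trans_le zero_le_two
    · exact Polynomial.natDegree_C_mul_X_pow_le _ _
  · simp only [Polynomial.eval_mul, Polynomial.eval_C, Polynomial.eval_comp, Polynomial.eval_sub,
      Polynomial.eval_pow, Polynomial.eval_X, zero_pow two_ne_zero, mul_zero, sub_zero, ← htdef,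
      inv_mul_cancel₀ ht.ne']
  · simp only [Polynomial.eval_mul, Polynomial.eval_C, Polynomial.eval_comp, Polynomial.eval_sub,
      Polynomial.eval_pow, Polynomial.eval_X, abs_mul, abs_inv, abs_of_pos ht]
    have harg : x₀ - 2 / (b ^ 2 - a ^ 2) * r ^ 2 =
        (b ^ 2 + a ^ 2 - 2 * r ^ 2) / (b ^ 2 - a ^ 2) := by
      ring
    have har' : a ^ 2 ≤ r ^ 2 := sq_le_sq.2 (by rwa [abs_of_pos ha])
    have hrb' : r ^ 2 ≤ b ^ 2 := sq_le_sq.2 (hrb.trans (le_abs_self b))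
    refine mul_le_of_le_one_right (inv_nonneg.2 ht.le)
      (Polynomial.Chebyshev.abs_eval_T_real_le_one j ?_)
    rw [harg, abs_div, abs_of_pos hpos, div_le_one hpos, abs_le]
    constructor <;> linarith

end

/-! ### The convergence rate -/

section

variable {ε : ℝ}

/-- The factor by which the bound on the MINRES residual decreases in each step. -/
def minresRate (ε : ℝ) : ℝ :=
  √((2 + 3 * ε) / (4 + 3 * ε))

/-- The quotient `(b - a) / (b + a)` of the eigenvalue bounds `a = 1 / 2` and
`b = 6 / 5 * (1 + ε)`, which governs Chebyshev polynomials on `[-b, -a] ∪ [a, b]`. -/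
def chebyshevRatio (ε : ℝ) : ℝ :=
  (7 + 12 * ε) / (17 + 12 * ε)

theorem sq_minresRate (hε : 0 ≤ ε) : minresRate ε ^ 2 = (2 + 3 * ε) / (4 + 3 * ε) :=
  Real.sq_sqrt (by positivity)

theorem minresRate_nonneg (ε : ℝ) : 0 ≤ minresRate ε :=
  Real.sqrt_nonneg _

theorem minresRate_lt_one (hε : 0 ≤ ε) : minresRate ε < 1 := by
  rw [minresRate, Real.sqrt_lt' one_pos, one_pow, div_lt_one (by positivity)]
  linarith

theorem sqrt_half_le_minresRate (hε : 0 ≤ ε) : √(1 / 2) ≤ minresRate ε := by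
  refine Real.sqrt_le_sqrt ?_
  rw [div_le_div_iff₀ two_pos (by positivity)]
  linarith

theorem sqrt_half_lt_minresRate (hε : 0 < ε) : √(1 / 2) < minresRate ε := by
  refine Real.sqrt_lt_sqrt (by norm_num) ?_
  rw [div_lt_div_iff₀ two_pos (by positivity)]
  linarith

theorem chebyshevRatio_pos (hε : 0 ≤ ε) : 0 < chebyshevRatio ε := by
  rw [chebyshevRatio]
  positivity

theorem chebyshevRatio_le (hε : 0 ≤ ε) : chebyshevRatio ε ≤ minresRate ε ^ 2 := by
  rw [sq_minresRate hε, chebyshevRatio, div_le_div_iff₀ (by positivity) (by positivity)]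
  nlinarith

theorem sq_chebyshevRatio_le (hε : 0 ≤ ε) : chebyshevRatio ε ^ 2 ≤ minresRate ε ^ 5 := by
  have hsq : (chebyshevRatio ε ^ 2) ^ 2 ≤ (minresRate ε ^ 2) ^ 5 := by
    rw [sq_minresRate hε, chebyshevRatio, ← pow_mul, div_pow, div_pow,
      div_le_div_iff₀ (by positivity) (by positivity), ← sub_nonneg]
    ring_nf
    positivity
  refine le_of_sq_le_sq ?_ (pow_nonneg (minresRate_nonneg ε) 5)
  rwa [pow_right_comm (minresRate ε)]

theorem chebyshevRatio_le_mul (hε : 0 ≤ ε) :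
    chebyshevRatio ε ≤ minresRate ε ^ 3 * (1 + chebyshevRatio ε ^ 2) := by
  have hsq : chebyshevRatio ε ^ 2 ≤ (minresRate ε ^ 2) ^ 3 * (1 + chebyshevRatio ε ^ 2) ^ 2 := by
    have hone : 1 + chebyshevRatio ε ^ 2 =
        (338 + 576 * ε + 288 * ε ^ 2) / (17 + 12 * ε) ^ 2 := by
      rw [chebyshevRatio]
      field_simp
      ring
    rw [hone, sq_minresRate hε, chebyshevRatio, div_pow, div_pow, div_pow, div_mul_div_comm,
      div_le_div_iff₀ (by positivity) (by positivity), ← sub_nonneg]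
    ring_nf
    positivity
  refine le_of_sq_le_sq ?_ (mul_nonneg (pow_nonneg (minresRate_nonneg ε) 3) (by positivity))
  rwa [mul_pow, ← pow_mul, mul_comm 3 2, pow_mul]

/-- For odd `k = 2 j + 1` the exponent of `ρ = chebyshevRatio ε` is rounded down. This is made up
for by the `1 + ρ²` in the denominator when `j = 1`, and by `ρ² ≤ ω⁵` with `ω = minresRate ε` when
`j ≥ 2`. -/
theorem two_mul_pow_chebyshevRatio_div_le (hε : 0 ≤ ε) (k : ℕ) :
    2 * chebyshevRatio ε ^ (k / 2) / (1 + (chebyshevRatio ε ^ (k / 2)) ^ 2) ≤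
      2 * minresRate ε ^ k := by
  have hρ := chebyshevRatio_pos hε
  have hω := minresRate_nonneg ε
  have hdrop : ∀ j, 2 * chebyshevRatio ε ^ j / (1 + (chebyshevRatio ε ^ j) ^ 2) ≤
      2 * chebyshevRatio ε ^ j := fun j =>
    div_le_self (by positivity) (le_add_of_nonneg_right (sq_nonneg _))
  obtain ⟨j, rfl | rfl⟩ := Nat.even_or_odd' k
  · rw [Nat.mul_div_cancel_left j two_pos, pow_mul]
    refine (hdrop j).trans ?_
    gcongr
    exact chebyshevRatio_le hε
  rw [show (2 * j + 1) / 2 = j by omega]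
  obtain rfl | rfl | hj : j = 0 ∨ j = 1 ∨ 2 ≤ j := by omega
  · have hhalf : (1 / 2 : ℝ) ≤ minresRate ε :=
      (Real.le_sqrt' (by norm_num)).2 (by norm_num) |>.trans (sqrt_half_le_minresRate hε)
    norm_num
    linarith
  · rw [pow_one, div_le_iff₀ (by positivity), mul_assoc]
    exact mul_le_mul_of_nonneg_left (chebyshevRatio_le_mul hε) zero_le_two
  · refine (hdrop j).trans ?_
    gcongr 2 * ?_
    refine le_of_sq_le_sq ?_ (by positivity)
    calc (chebyshevRatio ε ^ j) ^ 2 = (chebyshevRatio ε ^ 2) ^ j := by ring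
      _ ≤ (minresRate ε ^ 5) ^ j := by
          gcongr
          exact sq_chebyshevRatio_le hε
      _ = minresRate ε ^ (5 * j) := by rw [pow_mul]
      _ ≤ minresRate ε ^ ((2 * j + 1) * 2) :=
          pow_le_pow_of_le_one hω (minresRate_lt_one hε).le (by omega)
      _ = (minresRate ε ^ (2 * j + 1)) ^ 2 := by rw [pow_mul]

theorem exists_polynomial_abs_eval_le_minresRate (hε : 0 ≤ ε) (k : ℕ) :
    ∃ p : Polynomial ℝ, p.natDegree ≤ k ∧ p.eval 0 = 1 ∧
      ∀ r : ℝ, 1 / 2 ≤ |r| → |r| ≤ 6 / 5 * (1 + ε) → |p.eval r| ≤ 2 * minresRate ε ^ k := by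
  have hab : 1 / 2 < 6 / 5 * (1 + ε) := by linarith
  obtain ⟨p, hdeg, hp0, hp⟩ := exists_polynomial_abs_eval_le one_half_pos hab (k / 2)
  refine ⟨p, hdeg.trans (Nat.mul_div_le k 2), hp0, fun r hlow hup => (hp r hlow hup).trans ?_⟩
  have hratio : (6 / 5 * (1 + ε) - 1 / 2) / (6 / 5 * (1 + ε) + 1 / 2) = chebyshevRatio ε := by
    rw [chebyshevRatio, div_eq_div_iff (by positivity) (by positivity)]
    ring
  rw [eval_chebyshevT_of_intervals one_half_pos hab, hratio, inv_div]
  exact two_mul_pow_chebyshevRatio_div_le hε k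

theorem sqrt_one_add_sq_sub_one_nonneg (μ : ℝ) : 0 ≤ √(1 + μ ^ 2) - 1 :=
  sub_nonneg.2 (Real.one_le_sqrt.2 (le_add_of_nonneg_right (sq_nonneg μ)))

theorem sqrt_one_add_sq_sub_one_pos {μ : ℝ} (hμ : μ ≠ 0) : 0 < √(1 + μ ^ 2) - 1 := by
  rw [sub_pos, Real.lt_sqrt zero_le_one, one_pow]
  exact lt_add_of_pos_right 1 (by positivity)

theorem sqrt_one_add_sq_sub_one_le {μ : ℝ} (hμ : 0 ≤ μ) : √(1 + μ ^ 2) - 1 ≤ μ := by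
  rw [sub_le_iff_le_add, Real.sqrt_le_left (by linarith)]
  linarith

theorem sqrt_one_add_sq_sub_one_lt {μ : ℝ} (hμ : 0 < μ) : √(1 + μ ^ 2) - 1 < μ := by
  rw [sub_lt_iff_lt_add, Real.sqrt_lt' (by linarith)]
  linarith

end

/-! ### Preconditioned MINRES -/

section

/-- The minimizer is the preimage of the orthogonal projection of `g` onto `ψ K`. -/
theorem existsUnique_norm_sub_minimizer {V E : Type*} [AddCommGroup V] [Module ℝ V]
    [NormedAddCommGroup E] [InnerProductSpace ℝ E] {ψ : V →ₗ[ℝ] E} (hψ : Function.Injective ψ)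
    (K : Submodule ℝ V) [FiniteDimensional ℝ K] (g : E) :
    ∃! s, s ∈ K ∧ ∀ t ∈ K, ‖g - ψ s‖ ≤ ‖g - ψ t‖ := by
  set N := K.map ψ
  obtain ⟨s, hs, hproj⟩ : N.starProjection g ∈ K.map ψ := N.starProjection_apply_mem g
  have hpyth : ∀ t ∈ K, ‖g - ψ t‖ ^ 2 = ‖g - ψ s‖ ^ 2 + ‖ψ s - ψ t‖ ^ 2 := fun t ht => by
    have horth : inner ℝ (g - ψ s) (ψ s - ψ t) = 0 := by
      rw [hproj]
      exact N.starProjection_inner_eq_zero g _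
        (N.sub_mem (N.starProjection_apply_mem g) (Submodule.mem_map_of_mem ht))
    have h := norm_add_sq_eq_norm_sq_add_norm_sq_of_inner_eq_zero _ _ horth
    rwa [sub_add_sub_cancel, ← pow_two, ← pow_two, ← pow_two] at h
  refine ⟨s, ⟨hs, fun t ht => ?_⟩, fun t ⟨ht, hmin⟩ => hψ ?_⟩
  · refine le_of_sq_le_sq ?_ (norm_nonneg _)
    rw [hpyth t ht]
    exact le_add_of_nonneg_right (sq_nonneg _)
  · have hle : ‖g - ψ t‖ ^ 2 ≤ ‖g - ψ s‖ ^ 2 := pow_le_pow_left₀ (norm_nonneg _) (hmin s hs) 2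
    have hzero : ‖ψ s - ψ t‖ ^ 2 = 0 := le_antisymm (by linarith [hpyth t ht]) (sq_nonneg _)
    rw [sq_eq_zero_iff, norm_eq_zero, sub_eq_zero] at hzero
    exact hzero.symm

variable {ι : Type*} [Fintype ι]

theorem precNorm_eq_norm_toLp (Q : Matrix ι ι ℝ) (z : ι → ℝ) :
    precNorm (Qᵀ * Q) z = ‖WithLp.toLp 2 (Q *ᵥ z)‖ := by
  rw [precNorm, EuclideanSpace.norm_eq, ← Matrix.mulVec_mulVec, Matrix.dotProduct_transpose_mulVec,
    dotProduct]
  simp only [Real.norm_eq_abs, sq_abs, ← pow_two]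

variable [DecidableEq ι] {P M : Matrix ι ι ℝ}

theorem precResidual_add (P M : Matrix ι ι ℝ) (c u s : ι → ℝ) :
    precResidual P M c (u + s) = precResidual P M c u - (P⁻¹ * M) *ᵥ s := by
  rw [precResidual, precResidual, Matrix.mulVec_add, sub_sub]

theorem isMinresIterate_add_iff {c u₀ s : ι → ℝ} {k : ℕ} :
    IsMinresIterate P M c u₀ k (u₀ + s) ↔
      s ∈ krylov (P⁻¹ * M) (precResidual P M c u₀) k ∧
        ∀ t ∈ krylov (P⁻¹ * M) (precResidual P M c u₀) k,
          precNorm P (precResidual P M c u₀ - (P⁻¹ * M) *ᵥ s) ≤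
            precNorm P (precResidual P M c u₀ - (P⁻¹ * M) *ᵥ t) := by
  refine ⟨fun h => ⟨by simpa only [add_sub_cancel_left] using h.mem, fun t ht => ?_⟩,
    fun h => ⟨by simpa only [add_sub_cancel_left] using h.1, fun v hv => ?_⟩⟩
  · rw [← precResidual_add, ← precResidual_add]
    exact h.minimal _ (by rwa [add_sub_cancel_left])
  · obtain ⟨t, rfl⟩ : ∃ t, v = u₀ + t := ⟨v - u₀, (add_sub_cancel u₀ v).symm⟩
    rw [precResidual_add, precResidual_add]
    exact h.2 t (by rwa [add_sub_cancel_left] at hv)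

theorem isUnit_of_not_isPencilEigenvalue_zero (h : ¬ IsPencilEigenvalue M P 0) : IsUnit M := by
  rw [← Matrix.mulVec_injective_iff_isUnit, ← Matrix.coe_mulVecLin, ← LinearMap.ker_eq_bot,
    LinearMap.ker_eq_bot']
  intro v hv
  by_contra hv0
  exact h ⟨v, hv0, by rw [zero_smul]; exact hv⟩

theorem existsUnique_isMinresIterate (hP : P.PosDef) (hM : IsUnit M) (c u₀ : ι → ℝ) (k : ℕ) :
    ∃! u, IsMinresIterate P M c u₀ k u := by
  obtain ⟨Q, hQ, hPQ⟩ := exists_isUnit_eq_transpose_mul_self hP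
  let ψ : (ι → ℝ) →ₗ[ℝ] EuclideanSpace ℝ ι :=
    (WithLp.linearEquiv 2 ℝ (ι → ℝ)).symm.toLinearMap ∘ₗ (Q * (P⁻¹ * M)).mulVecLin
  have hψ : Function.Injective ψ := (WithLp.linearEquiv 2 ℝ (ι → ℝ)).symm.injective.comp
    (Matrix.mulVec_injective_of_isUnit
      (hQ.mul (((Matrix.isUnit_nonsing_inv_iff).2 hP.isUnit).mul hM)))
  have hnorm : ∀ s, precNorm P (precResidual P M c u₀ - (P⁻¹ * M) *ᵥ s) =
      ‖WithLp.toLp 2 (Q *ᵥ precResidual P M c u₀) - ψ s‖ := fun s => by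
    conv_lhs => rw [hPQ, precNorm_eq_norm_toLp, ← hPQ, Matrix.mulVec_sub, Matrix.mulVec_mulVec]
    rfl
  obtain ⟨s, hs, huniq⟩ := existsUnique_norm_sub_minimizer hψ
    (krylov (P⁻¹ * M) (precResidual P M c u₀) k) (WithLp.toLp 2 (Q *ᵥ precResidual P M c u₀))
  simp only [← hnorm, ← isMinresIterate_add_iff] at hs huniq
  refine ⟨u₀ + s, hs, fun u hu => ?_⟩
  rw [← huniq (u - u₀) (by rwa [add_sub_cancel]), add_sub_cancel]

theorem aeval_mulVec_mem_krylov (B : Matrix ι ι ℝ) (z : ι → ℝ) {s : Polynomial ℝ} {k : ℕ}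
    (hs : s.degree < k) : Polynomial.aeval B s *ᵥ z ∈ krylov B z k := by
  rw [Polynomial.aeval_eq_sum_range, Matrix.sum_mulVec]
  refine Submodule.sum_mem _ fun j _ => ?_
  rw [Matrix.smul_mulVec]
  by_cases hj : s.coeff j = 0
  · rw [hj, zero_smul]
    exact Submodule.zero_mem _
  · have hjk : j < k := by exact_mod_cast (Polynomial.le_degree_of_ne_zero hj).trans_lt hs
    exact Submodule.smul_mem _ _ (Submodule.subset_span ⟨⟨j, hjk⟩, rfl⟩)

theorem precNorm_precResidual_le (hP : P.PosDef) (hM : M.IsSymm) {p : Polynomial ℝ} {η : ℝ} {k : ℕ}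
    (hdeg : p.natDegree ≤ k) (hp0 : p.eval 0 = 1) (hη : 0 ≤ η)
    (hp : ∀ r, IsPencilEigenvalue M P r → |p.eval r| ≤ η) {c u₀ u : ι → ℝ}
    (hu : IsMinresIterate P M c u₀ k u) :
    precNorm P (precResidual P M c u) ≤ η * precNorm P (precResidual P M c u₀) := by
  have hdecomp : p = 1 - .X * -p.divX := by
    conv_lhs => rw [← Polynomial.X_mul_divX_add p, Polynomial.coeff_zero_eq_eval_zero, hp0]
    rw [map_one]
    ring
  set z := precResidual P M c u₀ with hz
  have hmem : Polynomial.aeval (P⁻¹ * M) (-p.divX) *ᵥ z ∈ krylov (P⁻¹ * M) z k := by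
    refine aeval_mulVec_mem_krylov _ _ ?_
    rw [Polynomial.degree_neg, Polynomial.degree_lt_iff_coeff_zero]
    intro j hj
    rw [Polynomial.coeff_divX, Polynomial.coeff_eq_zero_of_natDegree_lt (by omega)]
  have hres : precResidual P M c (u₀ + Polynomial.aeval (P⁻¹ * M) (-p.divX) *ᵥ z) =
      Polynomial.aeval (P⁻¹ * M) p *ᵥ z := by
    conv_rhs => rw [hdecomp]
    rw [precResidual_add, ← hz, map_sub, map_one, map_mul, Polynomial.aeval_X, Matrix.sub_mulVec,
      Matrix.one_mulVec, Matrix.mulVec_mulVec]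
  calc precNorm P (precResidual P M c u)
      ≤ precNorm P (Polynomial.aeval (P⁻¹ * M) p *ᵥ z) := by
        rw [← hres]
        exact hu.minimal _ (by rwa [add_sub_cancel_left])
    _ ≤ η * precNorm P z := precNorm_aeval_mulVec_le hP hM hη hp z

theorem precNorm_precResidual_le_minresRate {ε : ℝ} (hP : P.PosDef) (hM : M.IsSymm) (hε : 0 ≤ ε)
    (hr : ∀ r, IsPencilEigenvalue M P r → |r| ∈ Set.Icc (1 / 2) (6 / 5 * (1 + ε)))
    {c u₀ u : ι → ℝ} {k : ℕ} (hu : IsMinresIterate P M c u₀ k u) :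
    precNorm P (precResidual P M c u) ≤
      2 * minresRate ε ^ k * precNorm P (precResidual P M c u₀) := by
  obtain ⟨p, hdeg, hp0, hp⟩ := exists_polynomial_abs_eval_le_minresRate hε k
  exact precNorm_precResidual_le hP hM hdeg hp0
    (mul_nonneg zero_le_two (pow_nonneg (minresRate_nonneg ε) k))
    (fun r h => hp r (hr r h).1 (hr r h).2) hu

end

/-! ### The Grünwald coefficients -/

theorem grunwaldCoeff_zero (α : ℝ) : grunwaldCoeff α 0 = 1 := by simp [grunwaldCoeff]

theorem grunwaldCoeff_one (α : ℝ) : grunwaldCoeff α 1 = -α := by simp [grunwaldCoeff]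

theorem grunwaldCoeff_succ (α : ℝ) (k : ℕ) :
    ((k : ℝ) + 1) * grunwaldCoeff α (k + 1) = ((k : ℝ) - α) * grunwaldCoeff α k := by
  have h : (k.factorial : ℝ) ≠ 0 := by positivity
  unfold grunwaldCoeff
  rw [Finset.prod_range_succ, Nat.factorial_succ, pow_succ]
  push_cast
  field_simp
  ring

theorem grunwaldCoeff_two (α : ℝ) : grunwaldCoeff α 2 = α * (α - 1) / 2 := by
  have h := grunwaldCoeff_succ α 1
  rw [grunwaldCoeff_one] at h
  push_cast at h
  linear_combination h / 2

/-- The number `t k` for which the off-diagonal entries of the symmetric part of the Grünwald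
matrix are `-t |i - j|`. -/
def offCoeff (α : ℝ) (k : ℕ) : ℝ :=
  if k = 1 then (1 + grunwaldCoeff α 2) / 2 else grunwaldCoeff α (k + 1) / 2

/-- The tail sum `t k + t (k + 1) + ⋯` of `offCoeff`, for `k ≥ 1`. It is written with a finite sum:
the full sum is `α / 2` because the Grünwald coefficients add up to `0`. -/
def offTail (α : ℝ) (k : ℕ) : ℝ := α / 2 - ∑ l ∈ Finset.Ico 1 k, offCoeff α l

theorem offCoeff_one (α : ℝ) : offCoeff α 1 = (1 + α * (α - 1) / 2) / 2 := by
  simp [offCoeff, grunwaldCoeff_two]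

theorem offCoeff_of_two_le (α : ℝ) {k : ℕ} (hk : 2 ≤ k) :
    offCoeff α k = grunwaldCoeff α (k + 1) / 2 :=
  if_neg (by omega)

theorem offCoeff_two (α : ℝ) : offCoeff α 2 = α * (α - 1) * (2 - α) / 12 := by
  have h := grunwaldCoeff_succ α 2
  rw [grunwaldCoeff_two] at h
  rw [offCoeff_of_two_le α le_rfl]
  push_cast at h
  linear_combination h / 6

theorem offCoeff_succ (α : ℝ) {k : ℕ} (hk : 2 ≤ k) :
    ((k : ℝ) + 2) * offCoeff α (k + 1) = ((k : ℝ) + 1 - α) * offCoeff α k := by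
  have h := grunwaldCoeff_succ α (k + 1)
  rw [offCoeff_of_two_le α hk, offCoeff_of_two_le α (by omega)]
  push_cast at h
  linear_combination h / 2

theorem offTail_one (α : ℝ) : offTail α 1 = α / 2 := by simp [offTail]

theorem offTail_succ (α : ℝ) {k : ℕ} (hk : 1 ≤ k) :
    offTail α (k + 1) = offTail α k - offCoeff α k := by
  rw [offTail, offTail, Finset.sum_Ico_succ_top hk]
  ring

theorem offTail_two (α : ℝ) : offTail α 2 = (α - 1) * (2 - α) / 4 := by
  rw [offTail_succ α le_rfl, offTail_one, offCoeff_one]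
  ring

theorem sum_Ico_offCoeff (α : ℝ) {p q : ℕ} (hp : 1 ≤ p) (hpq : p ≤ q) :
    ∑ l ∈ Finset.Ico p q, offCoeff α l = offTail α p - offTail α q := by
  rw [offTail, offTail, ← Finset.sum_Ico_consecutive _ hp hpq]
  ring

theorem succ_mul_offCoeff_eq (α : ℝ) {k : ℕ} (hk : 2 ≤ k) :
    ((k : ℝ) + 1) * offCoeff α k = α * offTail α k := by
  induction k, hk using Nat.le_induction with
  | base =>
    rw [offCoeff_two, offTail_two]
    push_cast
    ring
  | succ k hk ih =>
    have h := offCoeff_succ α hk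
    rw [offTail_succ α (by omega)]
    push_cast
    linear_combination h + ih

section

variable {α : ℝ}

theorem offCoeff_nonneg (hα : α ∈ Set.Icc (1 : ℝ) 2) {k : ℕ} (hk : 1 ≤ k) : 0 ≤ offCoeff α k := by
  obtain ⟨h1, h2⟩ := hα
  have hα0 : 0 ≤ α * (α - 1) := mul_nonneg (by linarith) (by linarith)
  obtain rfl | hk2 : k = 1 ∨ 2 ≤ k := by omega
  · rw [offCoeff_one]
    linarith
  clear hk
  induction k, hk2 using Nat.le_induction with
  | base =>
    rw [offCoeff_two]
    exact div_nonneg (mul_nonneg hα0 (by linarith)) (by norm_num)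
  | succ k hk ih =>
    have hk' : (2 : ℝ) ≤ k := by exact_mod_cast hk
    have h : 0 ≤ ((k : ℝ) + 2) * offCoeff α (k + 1) := by
      rw [offCoeff_succ α hk]
      exact mul_nonneg (by linarith) ih
    exact nonneg_of_mul_nonneg_right h (by linarith)

theorem offTail_nonneg (hα : α ∈ Set.Icc (1 : ℝ) 2) {k : ℕ} (hk : 1 ≤ k) : 0 ≤ offTail α k := by
  have hα0 : 0 < α := by linarith [hα.1]
  rcases hk.eq_or_lt with rfl | hk
  · rw [offTail_one]
    positivity
  · refine (mul_nonneg_iff_of_pos_left hα0).1 ?_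
    rw [← succ_mul_offCoeff_eq α hk]
    exact mul_nonneg (by positivity) (offCoeff_nonneg hα (by omega))

theorem antitoneOn_mul_offTail (hα : α ∈ Set.Icc (1 : ℝ) 2) :
    AntitoneOn (fun k : ℕ => (k : ℝ) * offTail α k) (Set.Ici 1) := by
  refine antitoneOn_nat_Ici_of_succ_le fun k hk => ?_
  have htail := offTail_nonneg hα hk
  rcases hk.eq_or_lt with rfl | hk
  · simp only [Nat.reduceAdd, offTail_one, offTail_two]
    push_cast
    nlinarith [hα.1]
  · have h := succ_mul_offCoeff_eq α hk
    rw [offTail_succ α (by omega)]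
    push_cast
    nlinarith [hα.1]

theorem antitoneOn_offTail (hα : α ∈ Set.Icc (1 : ℝ) 2) :
    AntitoneOn (offTail α) (Set.Ici 1) :=
  antitoneOn_nat_Ici_of_succ_le fun k hk => by
    rw [offTail_succ α hk]
    exact sub_le_self _ (offCoeff_nonneg hα hk)

theorem antitoneOn_mul_offCoeff (hα : α ∈ Set.Icc (1 : ℝ) 2) :
    AntitoneOn (fun k : ℕ => (k : ℝ) * (k + 1) * offCoeff α k) (Set.Ici 1) := by
  refine antitoneOn_nat_Ici_of_succ_le fun k hk => ?_
  rcases hk.eq_or_lt with rfl | hk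
  · have hα0 : 0 ≤ α * (α - 1) := mul_nonneg (by linarith [hα.1]) (by linarith [hα.1])
    simp only [Nat.reduceAdd, offCoeff_one, offCoeff_two]
    push_cast
    nlinarith [hα.1]
  · have h := offCoeff_succ α hk
    have hpos : 0 ≤ ((k : ℝ) + 1) * ((α - 1) * offCoeff α k) :=
      mul_nonneg (by positivity)
        (mul_nonneg (by linarith [hα.1]) (offCoeff_nonneg hα (by omega)))
    push_cast
    nlinarith

theorem mul_offCoeff_le_of_ratio_le (hα : α ∈ Set.Icc (1 : ℝ) 2) {k l : ℕ} (hk : 1 ≤ k)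
    (hkl : k ≤ l) {c : ℝ} (hc : c * (k * (k + 1)) ≤ (l : ℝ) * (l + 1)) :
    c * offCoeff α l ≤ offCoeff α k := by
  have hanti : (l : ℝ) * (l + 1) * offCoeff α l ≤ k * (k + 1) * offCoeff α k :=
    antitoneOn_mul_offCoeff hα hk (hk.trans hkl) hkl
  have hscale := mul_le_mul_of_nonneg_right hc (offCoeff_nonneg hα (hk.trans hkl))
  have hkpos : (0 : ℝ) < k := by exact_mod_cast hk
  refine le_of_mul_le_mul_left (a := (k : ℝ) * (k + 1)) ?_ (mul_pos hkpos (by linarith))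
  linarith

theorem antitoneOn_offCoeff (hα : α ∈ Set.Icc (1 : ℝ) 2) :
    AntitoneOn (offCoeff α) (Set.Ici 1) := fun k hk l _ hkl => by
  have hkl' : (k : ℝ) ≤ l := by exact_mod_cast hkl
  have hratio : 1 * ((k : ℝ) * (k + 1)) ≤ l * (l + 1) := by
    rw [one_mul]
    gcongr
  simpa only [one_mul] using mul_offCoeff_le_of_ratio_le hα hk hkl hratio

/-! ### Weights for the diagonal dominance argument -/

/-- `offCoeff` cut off at the size `m` of the matrix. -/
def truncCoeff (α : ℝ) (m l : ℕ) : ℝ := if l < m then offCoeff α l else 0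

theorem truncCoeff_of_le (α : ℝ) {m l : ℕ} (h : m ≤ l) : truncCoeff α m l = 0 :=
  if_neg (by omega)

theorem truncCoeff_nonneg (hα : α ∈ Set.Icc (1 : ℝ) 2) (m : ℕ) {l : ℕ} (hl : 1 ≤ l) :
    0 ≤ truncCoeff α m l := by
  unfold truncCoeff
  split_ifs
  exacts [offCoeff_nonneg hα hl, le_rfl]

theorem truncCoeff_le (hα : α ∈ Set.Icc (1 : ℝ) 2) (m : ℕ) {l : ℕ} (hl : 1 ≤ l) :
    truncCoeff α m l ≤ offCoeff α l := by
  unfold truncCoeff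
  split_ifs
  exacts [le_rfl, offCoeff_nonneg hα hl]

theorem mul_truncCoeff_add_le_of_ratio_le (hα : α ∈ Set.Icc (1 : ℝ) 2) (m : ℕ) {I J : ℕ}
    (hJI : J < I) {c : ℝ} (hc0 : 0 ≤ c)
    (hc : c * (((I : ℝ) - J) * (I - J + 1)) ≤ ((I : ℝ) + J) * (I + J + 1)) :
    c * truncCoeff α m (I + J) ≤ offCoeff α (I - J) := by
  refine (mul_le_mul_of_nonneg_left (truncCoeff_le hα m (by omega)) hc0).trans
    (mul_offCoeff_le_of_ratio_le hα (by omega) (by omega) ?_)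
  rwa [Nat.cast_sub hJI.le, Nat.cast_add]

theorem sum_truncCoeff_le (hα : α ∈ Set.Icc (1 : ℝ) 2) (m I : ℕ) {s : Finset ℕ} {p : ℕ}
    (hp : 1 ≤ p) (hs : ∀ J ∈ s, p ≤ I + J) :
    ∑ J ∈ s, truncCoeff α m (I + J) ≤ offTail α p := by
  calc ∑ J ∈ s, truncCoeff α m (I + J)
      = ∑ J ∈ s with I + J < m, offCoeff α (I + J) := (Finset.sum_filter _ _).symm
    _ = ∑ l ∈ (s.filter (I + · < m)).image (I + ·), offCoeff α l :=
        (Finset.sum_image fun _ _ _ _ h => Nat.add_left_cancel h).symm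
    _ ≤ ∑ l ∈ Finset.Ico p (max p m), offCoeff α l := by
        refine Finset.sum_le_sum_of_subset_of_nonneg (fun l hl => ?_) fun l hl _ =>
          offCoeff_nonneg hα (hp.trans (Finset.mem_Ico.1 hl).1)
        obtain ⟨J, hJ, rfl⟩ := Finset.mem_image.1 hl
        obtain ⟨hJs, hJm⟩ := Finset.mem_filter.1 hJ
        exact Finset.mem_Ico.2 ⟨hs J hJs, lt_max_of_lt_right hJm⟩
    _ = offTail α p - offTail α (max p m) := sum_Ico_offCoeff α hp (le_max_left _ _)
    _ ≤ offTail α p := sub_le_self _ (offTail_nonneg hα (hp.trans (le_max_left p m)))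

/-- The multiples of `t (I + J)` that turn the weights `t |I - J|` into dominance weights for the
Toeplitz matrix minus `6` times its Hankel correction: the near-diagonal pairs give up `6`, and the
gain is spent on pairs far from the diagonal, mostly on the shorter row. -/
def cornerFactor (I J : ℕ) : ℝ :=
  (if 3 * J < I then 3 / 2 else 0) + (if I ≤ 2 * J ∧ J ≤ 2 * I then -6 else 0) +
    (if 7 * I ≤ 2 * J then 9 else 0)

theorem sum_leftCorner_le (hα : α ∈ Set.Icc (1 : ℝ) 2) (m : ℕ) {I : ℕ} (hI : 1 ≤ I) :
    3 / 2 * ∑ J ∈ Finset.Icc 1 m with 3 * J < I, truncCoeff α m (I + J) ≤ offTail α (I + 1) := by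
  have hcard : 3 * (((Finset.Icc 1 m).filter (3 * · < I)).card : ℝ) ≤ I := by
    have hsub : (Finset.Icc 1 m).filter (3 * · < I) ⊆ Finset.Icc 1 (I / 3) := fun J hJ => by
      simp only [Finset.mem_filter, Finset.mem_Icc] at hJ ⊢
      omega
    have := Finset.card_le_card hsub
    rw [Nat.card_Icc] at this
    exact_mod_cast (by omega : 3 * ((Finset.Icc 1 m).filter (3 * · < I)).card ≤ I)
  have hterm : ∀ J ∈ (Finset.Icc 1 m).filter (3 * · < I),
      truncCoeff α m (I + J) ≤ offCoeff α (I + 1) := fun J hJ => by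
    have hJ1 : 1 ≤ J := (Finset.mem_Icc.1 (Finset.mem_filter.1 hJ).1).1
    exact (truncCoeff_le hα m (by omega)).trans
      (antitoneOn_offCoeff hα (Set.mem_Ici.2 (by omega)) (Set.mem_Ici.2 (by omega)) (by omega))
  have hsum := Finset.sum_le_card_nsmul _ _ _ hterm
  rw [nsmul_eq_mul] at hsum
  have heq := succ_mul_offCoeff_eq α (by omega : 2 ≤ I + 1)
  push_cast at heq
  have hcoeff := mul_le_mul_of_nonneg_right hcard (offCoeff_nonneg hα (by omega : 1 ≤ I + 1))
  have htail := mul_le_mul_of_nonneg_right hα.2 (offTail_nonneg hα (by omega : 1 ≤ I + 1))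
  linarith [offCoeff_nonneg hα (by omega : 1 ≤ I + 1)]

theorem sum_nearCorner_eq (α : ℝ) {m I : ℕ} (hI : 1 ≤ I) (hm : 3 * I < m) :
    ∑ J ∈ Finset.Icc 1 m with I ≤ 2 * J ∧ J ≤ 2 * I, truncCoeff α m (I + J) =
      offTail α (I + (I + 1) / 2) - offTail α (3 * I + 1) := by
  rw [← sum_Ico_offCoeff α (by omega) (by omega)]
  refine Finset.sum_nbij' (I + ·) (· - I) ?_ ?_ ?_ ?_ ?_
  all_goals
    intro J hJ
    simp only [Finset.mem_filter, Finset.mem_Icc, Finset.mem_Ico] at hJ ⊢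
  case refine_5 => exact if_pos (by omega)
  all_goals omega

theorem offTail_corner_le (hα : α ∈ Set.Icc (1 : ℝ) 2) {I : ℕ} (hI : 1 ≤ I) :
    offTail α (I + 1) - 6 * (offTail α (I + (I + 1) / 2) - offTail α (3 * I + 1)) +
      9 * offTail α (I + (7 * I + 1) / 2) ≤ offTail α I := by
  obtain ⟨N, hN⟩ : ∃ N, N = I + (I + 1) / 2 := ⟨_, rfl⟩
  obtain ⟨p, hp⟩ : ∃ p, p = I + (7 * I + 1) / 2 := ⟨_, rfl⟩
  rw [← hN, ← hp]
  have hanti : ∀ k l : ℕ, 1 ≤ k → k ≤ l → (l : ℝ) * offTail α l ≤ k * offTail α k :=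
    fun k l hk hkl => antitoneOn_mul_offTail hα hk (hk.trans hkl) hkl
  have hN2 : 2 * (N : ℝ) ≤ 3 * I + 1 := by exact_mod_cast (by omega : 2 * N ≤ 3 * I + 1)
  have hp2 : 9 * (I : ℝ) ≤ 2 * p := by exact_mod_cast (by omega : 9 * I ≤ 2 * p)
  have hI0 : (0 : ℝ) < I := by exact_mod_cast hI
  have hgN : 0 ≤ offTail α N := offTail_nonneg hα (by omega)
  have hnear : 2 * offTail α (3 * I + 1) ≤ offTail α N := by
    have h := hanti N (3 * I + 1) (by omega) (by omega)
    push_cast at h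
    refine le_of_mul_le_mul_left (a := 3 * (I : ℝ) + 1) ?_ (by positivity)
    nlinarith
  have hfar : 9 * (I * offTail α p) ≤ (3 * I + 1) * offTail α N := by
    have h := hanti N p (by omega) (by omega)
    have hgp : 0 ≤ offTail α p := offTail_nonneg hα (by omega)
    nlinarith
  have hfirst := hanti I (I + 1) hI (by omega)
  have hnext : offTail α N ≤ offTail α (I + 1) :=
    antitoneOn_offTail hα (Set.mem_Ici.2 (by omega)) (Set.mem_Ici.2 (by omega)) (by omega)
  push_cast at hfirst
  refine le_of_mul_le_mul_left (a := (I : ℝ)) ?_ hI0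
  nlinarith

theorem sum_cornerFactor_mul_le (hα : α ∈ Set.Icc (1 : ℝ) 2) (m : ℕ) {I : ℕ} (hI : 1 ≤ I) :
    ∑ J ∈ Finset.Icc 1 m, cornerFactor I J * truncCoeff α m (I + J) ≤ offTail α I := by
  simp only [cornerFactor, add_mul, ite_mul, zero_mul, Finset.sum_add_distrib, ← Finset.sum_filter,
    ← Finset.mul_sum]
  have hleft := sum_leftCorner_le hα m hI
  by_cases hm : 9 * I < 2 * m
  · have hfar : ∑ J ∈ Finset.Icc 1 m with 7 * I ≤ 2 * J, truncCoeff α m (I + J) ≤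
        offTail α (I + (7 * I + 1) / 2) :=
      sum_truncCoeff_le hα m I (by omega) fun J hJ => by
        have := (Finset.mem_filter.1 hJ).2
        omega
    rw [sum_nearCorner_eq α hI (by omega)]
    linarith [offTail_corner_le hα hI]
  · have hnear : 0 ≤ ∑ J ∈ Finset.Icc 1 m with I ≤ 2 * J ∧ J ≤ 2 * I, truncCoeff α m (I + J) :=
      Finset.sum_nonneg fun J _ => truncCoeff_nonneg hα m (by omega)
    have hfar : ∑ J ∈ Finset.Icc 1 m with 7 * I ≤ 2 * J, truncCoeff α m (I + J) = 0 :=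
      Finset.sum_eq_zero fun J hJ => truncCoeff_of_le α (by
        have := (Finset.mem_filter.1 hJ).2
        omega)
    have htail : offTail α (I + 1) ≤ offTail α I :=
      antitoneOn_offTail hα hI (Set.mem_Ici.2 (by omega)) (by omega)
    linarith

/-- Dominance weights `t |I - J| + W I J` for the pairs `I ≠ J` of the Toeplitz matrix with
off-diagonal entries `-t |I - J|`, minus `β` times the upper left corner of its Hankel correction.
Rows and columns are counted from `1`, so that the corner entries are `-t (I + J)` for `I + J < m`;
the lower right corner is the mirror image of the upper left one. -/
structure IsCornerWeight (α : ℝ) (m : ℕ) (β : ℝ) (W : ℕ → ℕ → ℝ) : Prop where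
  eq_zero : ∀ I J, m ≤ I + J → W I J = 0
  diag : ∀ I, 1 ≤ I → W I I = -(β * truncCoeff α m (I + I))
  sum_le : ∀ I, 1 ≤ I → ∑ J ∈ Finset.Icc 1 m, W I J ≤ offTail α I
  nonneg : ∀ I J, 1 ≤ I → 1 ≤ J → I ≠ J → 0 ≤ offCoeff α (Nat.dist I J) + W I J
  sq_le : ∀ I J, 1 ≤ I → 1 ≤ J → I ≠ J →
    (β * truncCoeff α m (I + J) - offCoeff α (Nat.dist I J)) ^ 2 ≤
      (offCoeff α (Nat.dist I J) + W I J) * (offCoeff α (Nat.dist I J) + W J I)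

theorem isCornerWeight_neg_one (hα : α ∈ Set.Icc (1 : ℝ) 2) (m : ℕ) :
    IsCornerWeight α m (-1) fun I J => truncCoeff α m (I + J) where
  eq_zero _ _ h := truncCoeff_of_le α h
  diag _ _ := by ring
  sum_le I hI := sum_truncCoeff_le hα m I hI fun _ _ => Nat.le_add_right _ _
  nonneg I J hI _ hIJ :=
    add_nonneg (offCoeff_nonneg hα (Nat.dist_pos_of_ne hIJ)) (truncCoeff_nonneg hα m (by omega))
  sq_le I J _ _ _ := by
    rw [add_comm J I]
    exact le_of_eq (by ring)

theorem cornerFactor_pair_dominance (hα : α ∈ Set.Icc (1 : ℝ) 2) (m : ℕ) {I J : ℕ} (hJ : 1 ≤ J)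
    (hJI : J < I) :
    0 ≤ offCoeff α (I - J) + cornerFactor I J * truncCoeff α m (I + J) ∧
    0 ≤ offCoeff α (I - J) + cornerFactor J I * truncCoeff α m (I + J) ∧
    (6 * truncCoeff α m (I + J) - offCoeff α (I - J)) ^ 2 ≤
      (offCoeff α (I - J) + cornerFactor I J * truncCoeff α m (I + J)) *
        (offCoeff α (I - J) + cornerFactor J I * truncCoeff α m (I + J)) := by
  have hb := truncCoeff_nonneg hα m (by omega : 1 ≤ I + J)
  have hratio := fun {c : ℝ} => mul_truncCoeff_add_le_of_ratio_le (c := c) hα m hJI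
  have hJ1 : (1 : ℝ) ≤ J := by exact_mod_cast hJ
  have hJI1 : (J : ℝ) + 1 ≤ I := by exact_mod_cast hJI
  have hone : 1 * truncCoeff α m (I + J) ≤ offCoeff α (I - J) := hratio zero_le_one (by nlinarith)
  have hJI' : ¬ 3 * I < J ∧ ¬ 7 * I ≤ 2 * J ∧ J ≤ 2 * I := by omega
  simp only [cornerFactor, hJI', if_false, true_and, and_true, add_zero, zero_add]
  rcases le_or_gt I (2 * J) with hnear | hnear
  · have hIJ : (I : ℝ) ≤ 2 * J := by exact_mod_cast hnear
    have hsix : 6 * truncCoeff α m (I + J) ≤ offCoeff α (I - J) :=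
      hratio (by norm_num) (by nlinarith)
    have hregion : ¬ 3 * J < I ∧ ¬ 7 * J ≤ 2 * I := by omega
    simp only [hnear, hregion, if_true, if_false]
    exact ⟨by linarith, by linarith, by nlinarith⟩
  rcases le_or_gt (7 * J) (2 * I) with hfar | hfar
  · have hregion : ¬ I ≤ 2 * J ∧ 3 * J < I := by omega
    simp only [hfar, hregion, if_true, if_false]
    exact ⟨by linarith, by linarith, by nlinarith⟩
  · have hIJ : 2 * (I : ℝ) + 1 ≤ 7 * J := by exact_mod_cast hfar
    have hthree : 3 * truncCoeff α m (I + J) ≤ offCoeff α (I - J) :=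
      hratio (by norm_num) (by nlinarith)
    simp only [hnear.not_ge, hfar.not_ge, if_false]
    split_ifs <;> exact ⟨by linarith, by linarith, by nlinarith⟩

theorem isCornerWeight_six (hα : α ∈ Set.Icc (1 : ℝ) 2) (m : ℕ) :
    IsCornerWeight α m 6 fun I J => cornerFactor I J * truncCoeff α m (I + J) where
  eq_zero I J h := by rw [truncCoeff_of_le α h, mul_zero]
  diag I hI := by
    rw [cornerFactor, if_neg (by omega), if_pos (by omega), if_neg (by omega)]
    ring
  sum_le _ hI := sum_cornerFactor_mul_le hα m hI
  nonneg I J hI hJ hIJ := by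
    rcases lt_or_gt_of_ne hIJ with h | h
    · rw [Nat.dist_eq_sub_of_le h.le, add_comm I J]
      exact (cornerFactor_pair_dominance hα m hI h).2.1
    · rw [Nat.dist_eq_sub_of_le_right h.le]
      exact (cornerFactor_pair_dominance hα m hJ h).1
  sq_le I J hI hJ hIJ := by
    rcases lt_or_gt_of_ne hIJ with h | h
    · rw [Nat.dist_eq_sub_of_le h.le, add_comm I J, mul_comm (_ + _)]
      exact (cornerFactor_pair_dominance hα m hI h).2.2
    · rw [Nat.dist_eq_sub_of_le_right h.le, add_comm J I]
      exact (cornerFactor_pair_dominance hα m hJ h).2.2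

end

/-! ### Comparison of the Toeplitz matrix with its Tau matrix -/

theorem hankelCorrection_isSymm {m : ℕ} (T : Matrix (Fin m) (Fin m) ℝ) :
    (hankelCorrection T).IsSymm := by
  ext i j
  simp only [Matrix.transpose_apply, hankelCorrection, Matrix.of_apply, add_comm (j : ℕ)]

theorem symmPart_grunwaldMatrix_apply_self (α : ℝ) {m : ℕ} (i : Fin m) :
    symmPart (grunwaldMatrix m α) i i = α := by
  simp only [symmPart, grunwaldMatrix, Matrix.smul_apply, Matrix.add_apply, Matrix.transpose_apply,
    Matrix.of_apply, Nat.le_add_right, if_true, Nat.add_sub_cancel_left, grunwaldCoeff_one,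
    smul_eq_mul]
  ring

theorem symmPart_grunwaldMatrix_apply_of_lt (α : ℝ) {m : ℕ} {i j : Fin m} (h : j < i) :
    symmPart (grunwaldMatrix m α) i j = -offCoeff α (i - j) := by
  rw [Fin.lt_def] at h
  simp only [symmPart, grunwaldMatrix, offCoeff, Matrix.smul_apply, Matrix.add_apply,
    Matrix.transpose_apply, Matrix.of_apply, smul_eq_mul]
  rw [if_pos (by omega)]
  rcases eq_or_ne (i : ℕ) (j + 1) with hij | hij
  · rw [if_pos hij.le, if_pos (by omega), hij, show (j : ℕ) + 1 + 1 - j = 2 by omega,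
      Nat.sub_self, grunwaldCoeff_zero]
    ring
  · rw [if_neg (by omega), if_neg (by omega), show (i : ℕ) + 1 - j = i - j + 1 by omega]
    ring

theorem symmPart_grunwaldMatrix_apply_of_ne (α : ℝ) {m : ℕ} {i j : Fin m} (h : i ≠ j) :
    symmPart (grunwaldMatrix m α) i j = -offCoeff α (Nat.dist i j) := by
  rcases lt_or_gt_of_ne h with h | h
  · rw [← (symmPart_isSymm _).apply, symmPart_grunwaldMatrix_apply_of_lt α h,
      Nat.dist_eq_sub_of_le h.le]
  · rw [symmPart_grunwaldMatrix_apply_of_lt α h, Nat.dist_eq_sub_of_le_right h.le]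

theorem firstCol_symmPart_grunwaldMatrix (α : ℝ) (m : ℕ) {k : ℕ} (hk : 1 ≤ k) :
    firstCol (symmPart (grunwaldMatrix m α)) k = -truncCoeff α m k := by
  unfold firstCol truncCoeff
  split_ifs with h
  · exact symmPart_grunwaldMatrix_apply_of_lt α (Fin.mk_lt_mk.2 hk)
  · exact neg_zero.symm

theorem hankelCorrection_symmPart_grunwaldMatrix_apply (α : ℝ) {m : ℕ} (i j : Fin m) :
    hankelCorrection (symmPart (grunwaldMatrix m α)) i j =
      -(truncCoeff α m ((i + 1) + (j + 1)) + truncCoeff α m ((i.rev + 1) + (j.rev + 1))) := by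
  have hi := i.2
  have hj := j.2
  have hrev : 2 * m - ((i : ℕ) + j) = (i.rev + 1) + (j.rev + 1) := by
    simp only [Fin.val_rev]
    omega
  rw [hankelCorrection, Matrix.of_apply, firstCol_symmPart_grunwaldMatrix α m (by omega), hrev,
    firstCol_symmPart_grunwaldMatrix α m (by omega), neg_add,
    show (i : ℕ) + j + 2 = (i + 1) + (j + 1) by ring]

theorem sum_erase_offCoeff_dist (α : ℝ) {m : ℕ} (i : Fin m) :
    ∑ j ∈ Finset.univ.erase i, offCoeff α (Nat.dist i j) =
      α - offTail α (i + 1) - offTail α (i.rev + 1) := by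
  have hbelow : ∑ j ∈ Finset.Iio i, offCoeff α (Nat.dist i j) =
      ∑ k ∈ Finset.Ico 1 ((i : ℕ) + 1), offCoeff α k :=
    Finset.sum_bij' (fun j _ => (i : ℕ) - j) (fun k _ => ⟨i - k, by omega⟩)
      (fun j hj => by simp only [Finset.mem_Iio, Fin.lt_def, Finset.mem_Ico] at hj ⊢; omega)
      (fun k hk => by simp only [Finset.mem_Iio, Fin.lt_def, Finset.mem_Ico] at hk ⊢; omega)
      (fun j hj => by simp only [Finset.mem_Iio, Fin.lt_def, Fin.ext_iff] at hj ⊢; omega)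
      (fun k hk => by simp only [Finset.mem_Ico] at hk ⊢; omega)
      (fun j hj => by rw [Nat.dist_eq_sub_of_le_right (Finset.mem_Iio.1 hj).le])
  have habove : ∑ j ∈ Finset.Ioi i, offCoeff α (Nat.dist i j) =
      ∑ k ∈ Finset.Ico 1 ((i.rev : ℕ) + 1), offCoeff α k :=
    Finset.sum_bij' (fun j _ => (j : ℕ) - i)
      (fun k hk => ⟨i + k, by simp only [Finset.mem_Ico, Fin.val_rev] at hk; omega⟩)
      (fun j hj => by
        simp only [Finset.mem_Ioi, Fin.lt_def, Finset.mem_Ico, Fin.val_rev] at hj ⊢; omega)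
      (fun k hk => by simp only [Finset.mem_Ioi, Fin.lt_def, Finset.mem_Ico] at hk ⊢; omega)
      (fun j hj => by simp only [Finset.mem_Ioi, Fin.lt_def, Fin.ext_iff] at hj ⊢; omega)
      (fun k hk => by simp only [Finset.mem_Ico] at hk ⊢; omega)
      (fun j hj => by rw [Nat.dist_eq_sub_of_le (Finset.mem_Ioi.1 hj).le])
  have hsplit : Finset.univ.erase i = Finset.Iio i ∪ Finset.Ioi i := by
    ext j
    simp only [Finset.mem_erase, Finset.mem_univ, and_true, Finset.mem_union, Finset.mem_Iio,
      Finset.mem_Ioi, ne_iff_lt_or_gt]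
  have hdisj : Disjoint (Finset.Iio i) (Finset.Ioi i) :=
    Finset.disjoint_left.2 fun j hj hj' => (Finset.mem_Iio.1 hj).asymm (Finset.mem_Ioi.1 hj')
  rw [hsplit, Finset.sum_union hdisj, hbelow, habove, sum_Ico_offCoeff α le_rfl (by omega),
    sum_Ico_offCoeff α le_rfl (by omega), offTail_one]
  ring

namespace IsCornerWeight

variable {α β : ℝ} {m : ℕ} {W : ℕ → ℕ → ℝ}

theorem pair_dominance (hW : IsCornerWeight α m β W) {i j : Fin m} (hij : i ≠ j) :
    0 ≤ offCoeff α (Nat.dist i j) + (W (i + 1) (j + 1) + W (i.rev + 1) (j.rev + 1)) ∧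
    (β * (truncCoeff α m ((i + 1) + (j + 1)) + truncCoeff α m ((i.rev + 1) + (j.rev + 1))) -
        offCoeff α (Nat.dist i j)) ^ 2 ≤
      (offCoeff α (Nat.dist i j) + (W (i + 1) (j + 1) + W (i.rev + 1) (j.rev + 1))) *
        (offCoeff α (Nat.dist j i) + (W (j + 1) (i + 1) + W (j.rev + 1) (i.rev + 1))) := by
  have hdist_rev : ∀ i j : Fin m, Nat.dist i.rev j.rev = Nat.dist i j := fun i j => by
    simp only [Nat.dist, Fin.val_rev]
    omega
  wlog h : m ≤ (i.rev + 1) + (j.rev + 1) generalizing i j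
  · have hsum : m ≤ ((i : ℕ) + 1) + (j + 1) := by
      simp only [Fin.val_rev] at h
      omega
    have hrev := this (Fin.rev_injective.ne hij) (by simpa only [Fin.rev_rev] using hsum)
    simp only [Fin.rev_rev, hdist_rev] at hrev
    rwa [add_comm (W (i + 1) (j + 1)), add_comm (W (j + 1) (i + 1)),
      add_comm (truncCoeff α m ((i + 1) + (j + 1)))]
  have hij' : (i : ℕ) + 1 ≠ j + 1 := fun h => hij (Fin.ext (Nat.succ_injective h))
  have hdist : Nat.dist (i + 1) (j + 1) = Nat.dist i j := Nat.dist_add_add_right _ _ _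
  rw [hW.eq_zero (i.rev + 1) (j.rev + 1) h, hW.eq_zero (j.rev + 1) (i.rev + 1) (by omega),
    truncCoeff_of_le α h, add_zero, add_zero, add_zero, Nat.dist_comm j i, ← hdist]
  exact ⟨hW.nonneg _ _ (by omega) (by omega) hij', hW.sq_le _ _ (by omega) (by omega) hij'⟩

theorem sum_erase_le (hW : IsCornerWeight α m β W) (i : Fin m) :
    ∑ j ∈ Finset.univ.erase i,
        (offCoeff α (Nat.dist i j) + (W (i + 1) (j + 1) + W (i.rev + 1) (j.rev + 1))) ≤
      α + β *
        (truncCoeff α m ((i + 1) + (i + 1)) + truncCoeff α m ((i.rev + 1) + (i.rev + 1))) := by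
  have hrow : ∀ k : Fin m, ∑ j : Fin m, W (k + 1) (j + 1) ≤ offTail α (k + 1) := fun k => by
    rw [← Finset.sum_range fun j => W (k + 1) (j + 1), Finset.range_eq_Ico,
      Finset.sum_Ico_add' (W (k + 1)) 0 m 1]
    exact hW.sum_le _ (by omega)
  have hrow_rev : ∑ j : Fin m, W (i.rev + 1) (j.rev + 1) ≤ offTail α (i.rev + 1) :=
    (Equiv.sum_comp Fin.revPerm fun j : Fin m => W (i.rev + 1) (j + 1)).trans_le (hrow i.rev)
  rw [Finset.sum_add_distrib, sum_erase_offCoeff_dist,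
    Finset.sum_erase_eq_sub (Finset.mem_univ i), Finset.sum_add_distrib,
    hW.diag _ (by omega), hW.diag _ (by omega)]
  linarith [hrow i]

theorem posSemidef (hW : IsCornerWeight α m β W) :
    (symmPart (grunwaldMatrix m α) -
      β • hankelCorrection (symmPart (grunwaldMatrix m α))).PosSemidef := by
  refine posSemidef_of_dominance_weights
    ((symmPart_isSymm _).sub ((hankelCorrection_isSymm _).smul β))
    (fun i j => offCoeff α (Nat.dist i j) + (W (i + 1) (j + 1) + W (i.rev + 1) (j.rev + 1)))
    (fun i j hij => (hW.pair_dominance hij).1) (fun i j hij => ?_) fun i => ?_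
  · rw [Matrix.sub_apply, Matrix.smul_apply, symmPart_grunwaldMatrix_apply_of_ne α hij,
      hankelCorrection_symmPart_grunwaldMatrix_apply, smul_eq_mul, mul_neg, sub_neg_eq_add,
      neg_add_eq_sub]
    exact (hW.pair_dominance hij).2
  · rw [Matrix.sub_apply, Matrix.smul_apply, symmPart_grunwaldMatrix_apply_self,
      hankelCorrection_symmPart_grunwaldMatrix_apply, smul_eq_mul, mul_neg, sub_neg_eq_add]
    exact hW.sum_erase_le i

end IsCornerWeight

section

variable {α : ℝ}

theorem symmPart_grunwaldMatrix_sub_tauMatrix_posSemidef (hα : α ∈ Set.Icc (1 : ℝ) 2) (m : ℕ) :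
    (symmPart (grunwaldMatrix m α) -
      (1 / 2 : ℝ) • tauMatrix (symmPart (grunwaldMatrix m α))).PosSemidef := by
  convert (isCornerWeight_neg_one hα m).posSemidef.smul (by norm_num : (0 : ℝ) ≤ 1 / 2) using 1
  rw [tauMatrix]
  module

theorem tauMatrix_sub_symmPart_grunwaldMatrix_posSemidef (hα : α ∈ Set.Icc (1 : ℝ) 2) (m : ℕ) :
    ((6 / 5 : ℝ) • tauMatrix (symmPart (grunwaldMatrix m α)) -
      symmPart (grunwaldMatrix m α)).PosSemidef := by
  convert (isCornerWeight_six hα m).posSemidef.smul (by norm_num : (0 : ℝ) ≤ 1 / 5) using 1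
  rw [tauMatrix]
  module

theorem tauMatrix_symmPart_grunwaldMatrix_posSemidef (hα : α ∈ Set.Icc (1 : ℝ) 2) (m : ℕ) :
    (tauMatrix (symmPart (grunwaldMatrix m α))).PosSemidef := by
  convert ((symmPart_grunwaldMatrix_sub_tauMatrix_posSemidef hα m).add
    (tauMatrix_sub_symmPart_grunwaldMatrix_posSemidef hα m)).smul
    (by norm_num : (0 : ℝ) ≤ 10 / 7) using 1
  module

theorem symmPart_grunwaldMatrix_posSemidef (hα : α ∈ Set.Icc (1 : ℝ) 2) (m : ℕ) :
    (symmPart (grunwaldMatrix m α)).PosSemidef := by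
  convert (symmPart_grunwaldMatrix_sub_tauMatrix_posSemidef hα m).add
    ((tauMatrix_symmPart_grunwaldMatrix_posSemidef hα m).smul
      (by norm_num : (0 : ℝ) ≤ 1 / 2)) using 1
  module

end

/-! ### The symbol of the Grünwald matrix -/

theorem ofReal_grunwaldCoeff (α : ℝ) (k : ℕ) :
    (grunwaldCoeff α k : ℂ) = (-1) ^ k * Ring.choose (α : ℂ) k := by
  rw [← Complex.ofReal_choose, Ring.choose_eq_smul,
    Polynomial.descPochhammer_smeval_eq_ascPochhammer, Polynomial.ascPochhammer_smeval_cast,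
    Polynomial.ascPochhammer_smeval_eq_eval, ← descPochhammer_eval_eq_ascPochhammer,
    descPochhammer_eval_eq_prod_range, grunwaldCoeff, smul_eq_mul]
  push_cast
  ring

theorem hasSum_grunwaldCoeff_of_norm_lt_one (α : ℝ) {w : ℂ} (hw : ‖w‖ < 1) :
    HasSum (fun k : ℕ => (grunwaldCoeff α k : ℂ) * w ^ k) ((1 - w) ^ (α : ℂ)) := by
  have hball : -w ∈ Metric.eball (0 : ℂ) 1 := by
    simpa [Metric.mem_eball, edist_zero_right, ← ofReal_norm] using hw
  have h := Complex.one_add_cpow_hasFPowerSeriesOnBall_zero (a := (α : ℂ)).hasSum hball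
  simp only [binomialSeries_apply, List.ofFn_const, List.prod_replicate, zero_add, smul_eq_mul] at h
  rw [← sub_eq_add_neg] at h
  refine h.congr_fun fun k => ?_
  rw [ofReal_grunwaldCoeff, neg_pow w]
  ring

theorem continuousOn_one_sub_cpow {z : ℂ} (hz : 0 < z.re) :
    ContinuousOn (fun w : ℂ => (1 - w) ^ z) (Metric.closedBall 0 1) := fun w hw => by
  refine ContinuousAt.continuousWithinAt ?_
  have hnorm : ‖w‖ ≤ 1 := by simpa using hw
  rcases ((Complex.re_le_norm w).trans hnorm).eq_or_lt with hre | hre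
  · have hpos := Complex.re_eq_norm.1 (le_antisymm (Complex.re_le_norm w) (hre ▸ hnorm))
    obtain rfl : w = 1 := Complex.ext hre (Complex.nonneg_iff.1 hpos).2.symm
    exact ContinuousAt.comp_of_eq (f := fun v : ℂ => (1 - v, z))
      (g := fun p : ℂ × ℂ => p.1 ^ p.2) (Complex.continuousAt_cpow_zero_of_re_pos hz)
      (by fun_prop) (by rw [sub_self])
  · exact ContinuousAt.cpow (by fun_prop) (by fun_prop) (Or.inl (by simpa using hre))

section

variable {α : ℝ}

theorem summable_norm_grunwaldCoeff (hα : α ∈ Set.Icc (1 : ℝ) 2) :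
    Summable fun k : ℕ => ‖(grunwaldCoeff α k : ℂ)‖ := by
  have hsum : Summable fun k => offCoeff α (k + 2) := by
    refine summable_of_sum_range_le (c := offTail α 2) (fun k => offCoeff_nonneg hα (by omega))
      fun n => ?_
    rw [Finset.range_eq_Ico, Finset.sum_Ico_add' (offCoeff α) 0 n 2,
      sum_Ico_offCoeff α (by omega) (by omega)]
    linarith [offTail_nonneg hα (by omega : 1 ≤ n + 2)]
  refine (summable_nat_add_iff 3).1 ((hsum.mul_left 2).congr fun k => ?_)
  have hnonneg := offCoeff_nonneg hα (by omega : 1 ≤ k + 2)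
  have hcoeff : grunwaldCoeff α (k + 3) = 2 * offCoeff α (k + 2) := by
    rw [offCoeff_of_two_le α (by omega)]
    ring
  rw [Complex.norm_real, Real.norm_eq_abs, hcoeff, abs_of_nonneg (by positivity)]

theorem hasSum_grunwaldCoeff (hα : α ∈ Set.Icc (1 : ℝ) 2) {w : ℂ} (hw : ‖w‖ ≤ 1) :
    HasSum (fun k : ℕ => (grunwaldCoeff α k : ℂ) * w ^ k) ((1 - w) ^ (α : ℂ)) := by
  have hbound : ∀ (k : ℕ) (v : ℂ), v ∈ Metric.closedBall (0 : ℂ) 1 →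
      ‖(grunwaldCoeff α k : ℂ) * v ^ k‖ ≤ ‖(grunwaldCoeff α k : ℂ)‖ := fun k v hv => by
    rw [norm_mul, norm_pow]
    exact mul_le_of_le_one_right (norm_nonneg _)
      (pow_le_one₀ (norm_nonneg _) (mem_closedBall_zero_iff.1 hv))
  have hsummable := summable_norm_grunwaldCoeff hα
  have heq : Set.EqOn (fun v : ℂ => ∑' k : ℕ, (grunwaldCoeff α k : ℂ) * v ^ k)
      (fun v => (1 - v) ^ (α : ℂ)) (Metric.closedBall 0 1) :=
    Set.EqOn.of_subset_closure (s := Metric.ball 0 1)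
      (fun v hv => (hasSum_grunwaldCoeff_of_norm_lt_one α (mem_ball_zero_iff.1 hv)).tsum_eq)
      (continuousOn_tsum (fun k => by fun_prop) hsummable hbound)
      (continuousOn_one_sub_cpow (by simpa using zero_lt_one.trans_le hα.1))
      Metric.ball_subset_closedBall (closure_ball (0 : ℂ) one_ne_zero).ge
  have hw' := mem_closedBall_zero_iff.2 hw
  have hhasSum := (hsummable.of_norm_bounded fun k => hbound k w hw').hasSum
  rwa [show ∑' k : ℕ, (grunwaldCoeff α k : ℂ) * w ^ k = (1 - w) ^ (α : ℂ) from heq hw'] at hhasSum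

end

/-- The symbol of the Toeplitz matrices `grunwaldMatrix m α`: the function whose Fourier
coefficients are their entries. -/
def grunwaldSymbol (α θ : ℝ) : ℂ :=
  -(Complex.exp (-(θ * Complex.I)) * (1 - Complex.exp (θ * Complex.I)) ^ (α : ℂ))

theorem continuous_grunwaldSymbol {α : ℝ} (hα : 0 < α) : Continuous (grunwaldSymbol α) := by
  refine (Continuous.mul (by fun_prop) ?_).neg
  exact (continuousOn_one_sub_cpow (z := (α : ℂ)) (by simpa using hα)).comp_continuous
    (f := fun θ : ℝ => Complex.exp (θ * Complex.I)) (by fun_prop) fun θ => by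
      rw [mem_closedBall_zero_iff, Complex.norm_exp_ofReal_mul_I]

theorem one_sub_exp_mul_I_eq (θ : ℝ) :
    1 - Complex.exp (θ * Complex.I) =
      ((2 * Real.sin (θ / 2) : ℝ) : ℂ) * Complex.exp (((θ - Real.pi) / 2 : ℝ) * Complex.I) := by
  have hhalf : Complex.exp (θ * Complex.I) = Complex.exp (θ / 2 * Complex.I) ^ 2 := by
    rw [← Complex.exp_nat_mul]
    ring_nf
  have hinv : Complex.exp (-(θ / 2) * Complex.I) * Complex.exp (θ / 2 * Complex.I) = 1 := by
    rw [← Complex.exp_add, neg_mul, neg_add_cancel, Complex.exp_zero]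
  have hshift : Complex.exp (((θ - Real.pi) / 2 : ℝ) * Complex.I) =
      -Complex.I * Complex.exp (θ / 2 * Complex.I) := by
    rw [show (((θ - Real.pi) / 2 : ℝ) : ℂ) * Complex.I =
        -(Real.pi / 2 * Complex.I) + θ / 2 * Complex.I by push_cast; ring,
      Complex.exp_add, Complex.exp_neg, Complex.exp_pi_div_two_mul_I, Complex.inv_I]
  rw [hhalf, hshift]
  push_cast
  rw [Complex.two_sin]
  linear_combination -hinv + (Complex.exp (-(θ / 2) * Complex.I) *
    Complex.exp (θ / 2 * Complex.I) - Complex.exp (θ / 2 * Complex.I) ^ 2) * Complex.I_sq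

theorem grunwaldSymbol_eq (α : ℝ) {θ : ℝ} (hθ : θ ∈ Set.Ioo 0 (2 * Real.pi)) :
    grunwaldSymbol α θ = (((2 * Real.sin (θ / 2)) ^ α : ℝ) : ℂ) *
      Complex.exp (((1 - α / 2) * (Real.pi - θ) : ℝ) * Complex.I) := by
  have hsin : 0 < 2 * Real.sin (θ / 2) :=
    mul_pos two_pos (Real.sin_pos_of_pos_of_lt_pi (by linarith [hθ.1]) (by linarith [hθ.2]))
  have hexp : Complex.exp (((θ - Real.pi) / 2 : ℝ) * Complex.I) ≠ 0 := Complex.exp_ne_zero _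
  have hlog : Complex.log (Complex.exp (((θ - Real.pi) / 2 : ℝ) * Complex.I)) =
      ((θ - Real.pi) / 2 : ℝ) * Complex.I := by
    apply Complex.log_exp <;> simp only [Complex.im_ofReal_mul, Complex.I_im, mul_one] <;>
      linarith [hθ.1, hθ.2, Real.pi_pos]
  rw [grunwaldSymbol, one_sub_exp_mul_I_eq, Complex.cpow_def_of_ne_zero
    (mul_ne_zero (Complex.ofReal_ne_zero.2 hsin.ne') hexp), Complex.log_ofReal_mul hsin hexp, hlog,
    Real.rpow_def_of_pos hsin, Complex.ofReal_exp, neg_eq_neg_one_mul, ← Complex.exp_pi_mul_I,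
    ← Complex.exp_add, ← Complex.exp_add, ← Complex.exp_add]
  congr 1
  push_cast
  ring

theorem abs_sin_le_tan_mul_cos {φ ψ : ℝ} (hφ : |φ| ≤ ψ) (hψ : ψ < Real.pi / 2) :
    |Real.sin φ| ≤ Real.tan ψ * Real.cos φ := by
  have hφ0 := abs_nonneg φ
  have hcos : 0 < Real.cos ψ := Real.cos_pos_of_mem_Ioo ⟨by linarith, hψ⟩
  have hsin : 0 ≤ Real.sin (ψ - |φ|) :=
    Real.sin_nonneg_of_nonneg_of_le_pi (by linarith) (by linarith)
  rw [Real.sin_sub, Real.cos_abs] at hsin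
  rw [Real.abs_sin_eq_sin_abs_of_abs_le_pi (by linarith), Real.tan_eq_sin_div_cos,
    div_mul_eq_mul_div, le_div_iff₀ hcos]
  linarith

theorem abs_im_grunwaldSymbol_le {α : ℝ} (hα : α ∈ Set.Ioc (1 : ℝ) 2) {θ : ℝ}
    (hθ : θ ∈ Set.Ioo 0 (2 * Real.pi)) :
    |(grunwaldSymbol α θ).im| ≤ |Real.tan (α / 2 * Real.pi)| * (grunwaldSymbol α θ).re := by
  have hα2 : 0 ≤ 1 - α / 2 := by linarith [hα.2]
  have hψ : (1 - α / 2) * Real.pi < Real.pi / 2 := by nlinarith [hα.1, Real.pi_pos]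
  have hφ : |(1 - α / 2) * (Real.pi - θ)| ≤ (1 - α / 2) * Real.pi := by
    rw [abs_mul, abs_of_nonneg hα2]
    exact mul_le_mul_of_nonneg_left (abs_le.2 ⟨by linarith [hθ.2], by linarith [hθ.1]⟩) hα2
  have htan : |Real.tan (α / 2 * Real.pi)| = Real.tan ((1 - α / 2) * Real.pi) := by
    rw [show α / 2 * Real.pi = Real.pi - (1 - α / 2) * Real.pi by ring, Real.tan_pi_sub, abs_neg,
      abs_of_nonneg (Real.tan_nonneg_of_nonneg_of_le_pi_div_two
        (mul_nonneg hα2 Real.pi_pos.le) hψ.le)]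
  have hmod : 0 ≤ (2 * Real.sin (θ / 2)) ^ α := Real.rpow_nonneg (mul_nonneg two_pos.le
    (Real.sin_nonneg_of_nonneg_of_le_pi (by linarith [hθ.1]) (by linarith [hθ.2]))) α
  rw [grunwaldSymbol_eq α hθ, Complex.re_ofReal_mul, Complex.im_ofReal_mul,
    Complex.exp_ofReal_mul_I_re, Complex.exp_ofReal_mul_I_im, htan, abs_mul, abs_of_nonneg hmod,
    mul_left_comm]
  exact mul_le_mul_of_nonneg_left (abs_sin_le_tan_mul_cos hφ hψ) hmod

/-! ### Toeplitz matrices with a sectorial symbol -/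

theorem abs_im_integral_le {f : ℝ → ℂ} {a b μ : ℝ} (hab : a ≤ b)
    (hf : IntervalIntegrable f MeasureTheory.volume a b)
    (h : ∀ θ ∈ Set.Ioo a b, |(f θ).im| ≤ μ * (f θ).re) :
    |(∫ θ in a..b, f θ).im| ≤ μ * (∫ θ in a..b, f θ).re := by
  have hre : IntervalIntegrable (fun θ => (f θ).re) MeasureTheory.volume a b :=
    ⟨hf.1.re, hf.2.re⟩
  have him : IntervalIntegrable (fun θ => (f θ).im) MeasureTheory.volume a b :=
    ⟨hf.1.im, hf.2.im⟩
  calc |(∫ θ in a..b, f θ).im| = |∫ θ in a..b, (f θ).im| :=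
        congrArg _ (intervalIntegral.intervalIntegral_im hf).symm
    _ ≤ ∫ θ in a..b, |(f θ).im| := intervalIntegral.abs_integral_le_integral_abs hab
    _ ≤ ∫ θ in a..b, μ * (f θ).re :=
        intervalIntegral.integral_mono_on_of_le_Ioo hab him.abs (hre.const_mul μ) h
    _ = μ * ∫ θ in a..b, (f θ).re := intervalIntegral.integral_const_mul _ _
    _ = _ := congrArg _ (intervalIntegral.intervalIntegral_re hf)

/-- `A` is the Toeplitz matrix whose `(j, k)` entry is the Fourier coefficient of `f` with index
`j - k`. -/
def IsToeplitzOfSymbol {m : ℕ} (f : ℝ → ℂ) (A : Matrix (Fin m) (Fin m) ℝ) : Prop :=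
  ∀ j k : Fin m, ∫ θ in (0 : ℝ)..2 * Real.pi, f θ * Complex.exp (((k : ℂ) - j) * θ * Complex.I) =
    (2 * Real.pi : ℝ) * A j k

namespace IsToeplitzOfSymbol

variable {m : ℕ} {f : ℝ → ℂ} {A : Matrix (Fin m) (Fin m) ℝ}

theorem integral_mul_norm_sq (hA : IsToeplitzOfSymbol f A) (hf : Continuous f) (z : Fin m → ℂ) :
    ∫ θ in (0 : ℝ)..2 * Real.pi,
        f θ * ((‖∑ k, z k * Complex.exp (k * θ * Complex.I)‖ ^ 2 : ℝ) : ℂ) =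
      (2 * Real.pi : ℝ) * ∑ j, ∑ k, (starRingEnd ℂ) (z j) * z k * A j k := by
  have hexpand : ∀ θ : ℝ, f θ * ((‖∑ k, z k * Complex.exp (k * θ * Complex.I)‖ ^ 2 : ℝ) : ℂ) =
      ∑ j, ∑ k, (starRingEnd ℂ) (z j) * z k * (f θ * Complex.exp (((k : ℂ) - j) * θ * Complex.I)) :=
    fun θ => by
      rw [Complex.ofReal_pow, ← Complex.conj_mul', map_sum, Finset.sum_mul_sum, Finset.mul_sum]
      refine Finset.sum_congr rfl fun j _ => ?_
      rw [Finset.mul_sum]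
      refine Finset.sum_congr rfl fun k _ => ?_
      rw [map_mul, ← Complex.exp_conj, sub_mul, sub_mul, sub_eq_neg_add, Complex.exp_add]
      simp only [map_mul, map_natCast, Complex.conj_ofReal, Complex.conj_I, mul_neg]
      ring
  simp only [hexpand]
  rw [intervalIntegral.integral_finsetSum fun j _ =>
    Continuous.intervalIntegrable (by fun_prop) _ _, Finset.mul_sum]
  refine Finset.sum_congr rfl fun j _ => ?_
  rw [intervalIntegral.integral_finsetSum fun k _ =>
    Continuous.intervalIntegrable (by fun_prop) _ _, Finset.mul_sum]
  refine Finset.sum_congr rfl fun k _ => ?_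
  rw [intervalIntegral.integral_const_mul, hA j k]
  ring

theorem isSectorial (hA : IsToeplitzOfSymbol f A) (hf : Continuous f) {μ : ℝ}
    (h : ∀ θ ∈ Set.Ioo 0 (2 * Real.pi), |(f θ).im| ≤ μ * (f θ).re) : IsSectorial μ A :=
  fun x y => by
    set z : Fin m → ℂ := fun k => x k + y k * Complex.I
    have hform : ∑ j, ∑ k, (starRingEnd ℂ) (z j) * z k * A j k =
        ((x ⬝ᵥ A *ᵥ x + y ⬝ᵥ A *ᵥ y : ℝ) : ℂ) +
          ((x ⬝ᵥ A *ᵥ y - y ⬝ᵥ A *ᵥ x : ℝ) : ℂ) * Complex.I := by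
      simp only [dotProduct, Matrix.mulVec, Finset.mul_sum, Complex.ofReal_add, Complex.ofReal_sub,
        Complex.ofReal_sum, Complex.ofReal_mul, ← Finset.sum_add_distrib, ← Finset.sum_sub_distrib,
        Finset.sum_mul]
      refine Finset.sum_congr rfl fun j _ => Finset.sum_congr rfl fun k _ => ?_
      simp only [z, map_add, map_mul, Complex.conj_ofReal, Complex.conj_I]
      linear_combination -(y j * y k * A j k : ℂ) * Complex.I_sq
    have hint := abs_im_integral_le (μ := μ) (a := 0) (b := 2 * Real.pi) (by positivity)
      (f := fun θ => f θ * ((‖∑ k, z k * Complex.exp (k * θ * Complex.I)‖ ^ 2 : ℝ) : ℂ))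
      (Continuous.intervalIntegrable (by fun_prop) _ _) fun θ hθ => by
        rw [Complex.im_mul_ofReal, Complex.re_mul_ofReal, abs_mul, abs_sq,
          ← mul_assoc]
        exact mul_le_mul_of_nonneg_right (h θ hθ) (sq_nonneg _)
    rw [hA.integral_mul_norm_sq hf, hform, Complex.im_ofReal_mul, Complex.re_ofReal_mul, abs_mul,
      abs_of_pos Real.two_pi_pos, mul_left_comm] at hint
    simpa using le_of_mul_le_mul_left hint Real.two_pi_pos

end IsToeplitzOfSymbol

theorem integral_exp_int_mul_I (n : ℤ) :
    ∫ θ in (0 : ℝ)..2 * Real.pi, Complex.exp (n * θ * Complex.I) =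
      if n = 0 then ((2 * Real.pi : ℝ) : ℂ) else 0 := by
  split_ifs with hn
  · simp [hn]
  · have hc : (n : ℂ) * Complex.I ≠ 0 := mul_ne_zero (Int.cast_ne_zero.2 hn) Complex.I_ne_zero
    have hperiod : Complex.exp (n * Complex.I * ((2 * Real.pi : ℝ) : ℂ)) = 1 :=
      Complex.exp_eq_one_iff.2 ⟨n, by push_cast; ring⟩
    simp only [mul_right_comm (n : ℂ) _ Complex.I]
    rw [integral_exp_mul_complex hc, hperiod, Complex.ofReal_zero, mul_zero, Complex.exp_zero,
      sub_self, zero_div]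

theorem hasSum_grunwaldSymbol_mul_exp {α : ℝ} (hα : α ∈ Set.Icc (1 : ℝ) 2) (n : ℤ) (θ : ℝ) :
    HasSum (fun l : ℕ => -(grunwaldCoeff α l : ℂ) *
        Complex.exp (((l - 1 + n : ℤ) : ℂ) * θ * Complex.I))
      (grunwaldSymbol α θ * Complex.exp (n * θ * Complex.I)) := by
  have h := (hasSum_grunwaldCoeff hα (w := Complex.exp (θ * Complex.I))
    (Complex.norm_exp_ofReal_mul_I θ).le).mul_left
      (-Complex.exp (-(θ * Complex.I)) * Complex.exp (n * θ * Complex.I))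
  have hvalue : -Complex.exp (-(θ * Complex.I)) * Complex.exp (n * θ * Complex.I) *
      (1 - Complex.exp (θ * Complex.I)) ^ (α : ℂ) =
        grunwaldSymbol α θ * Complex.exp (n * θ * Complex.I) := by
    rw [grunwaldSymbol]
    ring
  rw [hvalue] at h
  refine h.congr_fun fun l => ?_
  rw [← Complex.exp_nat_mul, show ((l - 1 + n : ℤ) : ℂ) * θ * Complex.I =
      -(θ * Complex.I) + n * θ * Complex.I + l * (θ * Complex.I) by push_cast; ring,
    Complex.exp_add, Complex.exp_add]
  ring

theorem integral_grunwaldSymbol_mul_exp {α : ℝ} (hα : α ∈ Set.Icc (1 : ℝ) 2) (n : ℤ) :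
    ∫ θ in (0 : ℝ)..2 * Real.pi, grunwaldSymbol α θ * Complex.exp (n * θ * Complex.I) =
      (2 * Real.pi : ℝ) * (if n ≤ 1 then -grunwaldCoeff α (1 - n).toNat else 0 : ℝ) := by
  have hbound : ∀ (l : ℕ) (θ : ℝ), ‖-(grunwaldCoeff α l : ℂ) *
      Complex.exp (((l - 1 + n : ℤ) : ℂ) * θ * Complex.I)‖ ≤ ‖(grunwaldCoeff α l : ℂ)‖ :=
    fun l θ => by
      rw [norm_mul, norm_neg, ← Complex.ofReal_intCast, ← Complex.ofReal_mul,
        Complex.norm_exp_ofReal_mul_I, mul_one]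
  have hsum := intervalIntegral.hasSum_integral_of_dominated_convergence
    (μ := MeasureTheory.volume) (a := 0) (b := 2 * Real.pi) (fun l _ => ‖(grunwaldCoeff α l : ℂ)‖)
    (fun l => Continuous.aestronglyMeasurable (by fun_prop))
    (fun l => .of_forall fun θ _ => hbound l θ)
    (.of_forall fun _ _ => summable_norm_grunwaldCoeff hα) intervalIntegrable_const
    (.of_forall fun θ _ => hasSum_grunwaldSymbol_mul_exp hα n θ)
  simp only [intervalIntegral.integral_const_mul, integral_exp_int_mul_I] at hsum
  refine hsum.unique ?_
  split_ifs with hn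
  · convert hasSum_single (1 - n).toNat fun l hl => ?_ using 1
    · rw [if_pos (by omega)]
      push_cast
      ring
    · rw [if_neg (by omega), mul_zero]
  · rw [Complex.ofReal_zero, mul_zero]
    exact hasSum_zero.congr_fun fun l => by rw [if_neg (by omega), mul_zero]

theorem isToeplitzOfSymbol_grunwaldMatrix {α : ℝ} (hα : α ∈ Set.Icc (1 : ℝ) 2) (m : ℕ) :
    IsToeplitzOfSymbol (grunwaldSymbol α) (grunwaldMatrix m α) := fun j k => by
  have h := integral_grunwaldSymbol_mul_exp hα ((k : ℤ) - j)
  simp only [Int.cast_sub, Int.cast_natCast] at h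
  rw [h, grunwaldMatrix, Matrix.of_apply]
  congr 2
  refine if_congr (by omega) ?_ rfl
  rw [show (1 - ((k : ℤ) - j)).toNat = (j : ℕ) + 1 - k by omega]

theorem isSectorial_grunwaldMatrix {α : ℝ} (hα : α ∈ Set.Ioc (1 : ℝ) 2) (m : ℕ) :
    IsSectorial |Real.tan (α / 2 * Real.pi)| (grunwaldMatrix m α) :=
  (isToeplitzOfSymbol_grunwaldMatrix (Set.Ioc_subset_Icc_self hα) m).isSectorial
    (continuous_grunwaldSymbol (zero_lt_one.trans hα.1)) fun _ => abs_im_grunwaldSymbol_le hα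

/-! ### Multilevel matrices -/

section

variable {d : ℕ} {n : Fin d → ℕ}

theorem inDirection_apply (i : Fin d) (B : Matrix (Fin (n i)) (Fin (n i)) ℝ) (p q : Idx n) :
    inDirection i B p q = if ∀ j : {j // j ≠ i}, p j = q j then B (p i) (q i) else 0 := by
  have hupdate : ∀ j : {j // j ≠ i}, Function.update
      (fun j => (1 : Matrix (Fin (n j)) (Fin (n j)) ℝ)) i B j (p j) (q j) =
        if p j = q j then 1 else 0 := fun j => by
    rw [Function.update_of_ne j.2, Matrix.one_apply]
  rw [inDirection, multiKronecker, Matrix.of_apply, Fintype.prod_eq_mul_prod_subtype_ne _ i,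
    Function.update_self]
  simp only [hupdate, Finset.prod_ite_zero, Finset.prod_const_one, Finset.mem_univ, true_implies,
    mul_ite, mul_one, mul_zero]

theorem inDirection_add (i : Fin d) (B C : Matrix (Fin (n i)) (Fin (n i)) ℝ) :
    inDirection i (B + C) = inDirection i B + inDirection i C := by
  ext p q
  simp only [inDirection_apply, Matrix.add_apply]
  split_ifs
  exacts [rfl, (add_zero 0).symm]

theorem inDirection_smul (i : Fin d) (c : ℝ) (B : Matrix (Fin (n i)) (Fin (n i)) ℝ) :
    inDirection i (c • B) = c • inDirection i B := by
  ext p q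
  simp only [inDirection_apply, Matrix.smul_apply, smul_ite, smul_zero]

theorem inDirection_transpose (i : Fin d) (B : Matrix (Fin (n i)) (Fin (n i)) ℝ) :
    inDirection i Bᵀ = (inDirection i B)ᵀ := by
  ext p q
  simp only [Matrix.transpose_apply, inDirection_apply, eq_comm]

/-- The restriction of a multilevel vector to the line in direction `i` on which the other indices
are given by `r`. -/
def lineSlice (i : Fin d) (x : Idx n → ℝ) (r : (j : {j // j ≠ i}) → Fin (n j)) (k : Fin (n i)) :
    ℝ :=
  x ((Equiv.piSplitAt i fun j => Fin (n j)).symm (k, r))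

theorem dotProduct_inDirection_mulVec (i : Fin d) (B : Matrix (Fin (n i)) (Fin (n i)) ℝ)
    (x y : Idx n → ℝ) :
    x ⬝ᵥ inDirection i B *ᵥ y = ∑ r, lineSlice i x r ⬝ᵥ B *ᵥ lineSlice i y r := by
  set e := (Equiv.piSplitAt i fun j => Fin (n j)).symm
  have hself : ∀ k r, e (k, r) i = k := fun k r => by simp [e]
  have hother : ∀ k r (j : {j // j ≠ i}), e (k, r) j = r j := fun k r j => by simp [e, j.2]
  simp only [dotProduct, Matrix.mulVec]
  rw [← Equiv.sum_comp e, Fintype.sum_prod_type_right]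
  refine Finset.sum_congr rfl fun r _ => Finset.sum_congr rfl fun k _ => congrArg (_ * ·) ?_
  rw [← Equiv.sum_comp e, Fintype.sum_prod_type]
  refine Finset.sum_congr rfl fun l _ => ?_
  simp only [inDirection_apply, hself, hother, ← funext_iff, ite_mul, zero_mul, Finset.sum_ite_eq,
    Finset.mem_univ, if_true]
  rfl

theorem posSemidef_inDirection {i : Fin d} {B : Matrix (Fin (n i)) (Fin (n i)) ℝ}
    (hB : B.PosSemidef) : (inDirection i B : Matrix (Idx n) (Idx n) ℝ).PosSemidef := by
  obtain ⟨hsymm, hnonneg⟩ := posSemidef_iff_isSymm_and_nonneg.1 hB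
  refine posSemidef_iff_isSymm_and_nonneg.2 ⟨?_, fun x => ?_⟩
  · rw [Matrix.IsSymm, ← inDirection_transpose, hsymm.eq]
  · rw [dotProduct_inDirection_mulVec]
    exact Finset.sum_nonneg fun r _ => hnonneg _

theorem IsSectorial.inDirection {μ : ℝ} {i : Fin d} {B : Matrix (Fin (n i)) (Fin (n i)) ℝ}
    (hB : IsSectorial μ B) :
    IsSectorial μ (inDirection i B : Matrix (Idx n) (Idx n) ℝ) := fun x y => by
  simp only [dotProduct_inDirection_mulVec, ← Finset.sum_add_distrib, ← Finset.sum_sub_distrib,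
    Finset.mul_sum]
  exact (Finset.abs_sum_le_sum_abs _ _).trans (Finset.sum_le_sum fun r _ => hB _ _)

/-- The matrix `ν I + ∑ᵢ I ⊗ ⋯ ⊗ B i ⊗ ⋯ ⊗ I`: up to the shift `ν I`, the Kronecker sum of the
matrices `B i`. Both the coefficient matrix and its Tau preconditioner are of this form. -/
def kroneckerSum (ν : ℝ) (B : (i : Fin d) → Matrix (Fin (n i)) (Fin (n i)) ℝ) :
    Matrix (Idx n) (Idx n) ℝ :=
  ν • 1 + ∑ i, inDirection i (B i)

variable {ν ν' c μ : ℝ} {B C : (i : Fin d) → Matrix (Fin (n i)) (Fin (n i)) ℝ}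

theorem kroneckerSum_add :
    kroneckerSum (ν + ν') (fun i => B i + C i) = kroneckerSum ν B + kroneckerSum ν' C := by
  simp only [kroneckerSum, inDirection_add, Finset.sum_add_distrib, add_smul]
  abel

theorem kroneckerSum_smul :
    kroneckerSum (c * ν) (fun i => c • B i) = c • kroneckerSum ν B := by
  simp only [kroneckerSum, inDirection_smul, ← Finset.smul_sum, mul_smul, smul_add]

theorem kroneckerSum_sub_smul :
    kroneckerSum ν B - c • kroneckerSum ν' C =
      kroneckerSum (ν - c * ν') (fun i => B i - c • C i) := by
  simp only [sub_eq_add_neg, ← neg_smul, ← neg_mul, kroneckerSum_add, kroneckerSum_smul]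

theorem kroneckerSum_transpose : kroneckerSum ν (fun i => (B i)ᵀ) = (kroneckerSum ν B)ᵀ := by
  simp only [kroneckerSum, inDirection_transpose, Matrix.transpose_add, Matrix.transpose_smul,
    Matrix.transpose_one, Matrix.transpose_sum]

theorem kroneckerSum_symmPart :
    kroneckerSum ν (fun i => symmPart (B i)) = symmPart (kroneckerSum ν B) := by
  simp only [symmPart, ← kroneckerSum_transpose, ← kroneckerSum_add, ← kroneckerSum_smul]
  ring_nf

theorem posDef_kroneckerSum (hν : 0 < ν) (hB : ∀ i, (B i).PosSemidef) :
    (kroneckerSum ν B).PosDef :=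
  (Matrix.PosDef.one.smul hν).add_posSemidef
    (Matrix.posSemidef_sum _ fun i _ => posSemidef_inDirection (hB i))

theorem IsSectorial.kroneckerSum (hμ : 0 ≤ μ) (hν : 0 ≤ ν) (hB : ∀ i, IsSectorial μ (B i)) :
    IsSectorial μ (kroneckerSum ν B) :=
  ((IsSectorial.one hμ).smul hν).add (IsSectorial.sum fun i _ => (hB i).inDirection)

end

/-! ### The flip -/

section

variable {d : ℕ} {n : Fin d → ℕ}

/-- The involution of the multi-indices that reverses every coordinate. -/
def flipPerm (n : Fin d → ℕ) : Equiv.Perm (Idx n) := Equiv.piCongrRight fun _ => Fin.revPerm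

theorem flipPerm_symm (n : Fin d → ℕ) : (flipPerm n).symm = flipPerm n := rfl

theorem flipMatrix_eq_permMatrix (n : Fin d → ℕ) :
    flipMatrix n = (flipPerm n).permMatrix ℝ := by
  have hentry : ∀ (m : ℕ) (k l : Fin m), antiIdentity m k l = if k.rev = l then 1 else 0 :=
    fun m k l => by
      rw [antiIdentity, Matrix.of_apply]
      refine if_congr ?_ rfl rfl
      rw [Fin.ext_iff, Fin.val_rev]
      omega
  ext p q
  simp only [flipMatrix, multiKronecker, Matrix.of_apply, hentry, Finset.prod_ite_zero,
    Finset.prod_const_one, Finset.mem_univ, true_implies, Equiv.Perm.permMatrix,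
    PEquiv.toMatrix_apply, Equiv.toPEquiv_apply, Option.mem_some_iff]
  exact if_congr funext_iff.symm rfl rfl

theorem flipMatrix_mul (M : Matrix (Idx n) (Idx n) ℝ) :
    flipMatrix n * M = M.submatrix (flipPerm n) id := by
  rw [flipMatrix_eq_permMatrix, Equiv.Perm.permMatrix, PEquiv.toMatrix_toPEquiv_mul]

theorem mul_flipMatrix (M : Matrix (Idx n) (Idx n) ℝ) :
    M * flipMatrix n = M.submatrix id (flipPerm n) := by
  rw [flipMatrix_eq_permMatrix, Equiv.Perm.permMatrix, PEquiv.mul_toMatrix_toPEquiv, flipPerm_symm]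

theorem flipMatrix_isSymm (n : Fin d → ℕ) : (flipMatrix n).IsSymm := by
  rw [Matrix.IsSymm, flipMatrix_eq_permMatrix, Matrix.transpose_permMatrix]
  rfl

theorem flipMatrix_mul_self (n : Fin d → ℕ) : flipMatrix n * flipMatrix n = 1 := by
  have hinv : flipPerm n * flipPerm n = 1 := (flipPerm n).self_trans_symm
  rw [flipMatrix_eq_permMatrix, ← Matrix.permMatrix_mul, hinv, Matrix.permMatrix_one]

theorem flipMatrix_mul_isSymm {M : Matrix (Idx n) (Idx n) ℝ}
    (hM : M.submatrix (flipPerm n) (flipPerm n) = Mᵀ) : (flipMatrix n * M).IsSymm := by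
  rw [Matrix.IsSymm, Matrix.transpose_mul, (flipMatrix_isSymm n).eq, mul_flipMatrix,
    flipMatrix_mul, ← hM, Matrix.submatrix_submatrix]
  exact congrArg _ (flipPerm n).symm_comp_self

theorem flipMatrix_mul_mul_flipMatrix (M : Matrix (Idx n) (Idx n) ℝ) :
    flipMatrix n * M * flipMatrix n = M.submatrix (flipPerm n) (flipPerm n) := by
  rw [mul_flipMatrix, flipMatrix_mul, Matrix.submatrix_submatrix]
  rfl

theorem inDirection_submatrix_flipPerm (i : Fin d) (B : Matrix (Fin (n i)) (Fin (n i)) ℝ) :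
    (inDirection i B).submatrix (flipPerm n) (flipPerm n) =
      inDirection i (B.submatrix Fin.rev Fin.rev) := by
  ext p q
  simp only [Matrix.submatrix_apply, inDirection_apply]
  exact if_congr (forall_congr' fun j => Fin.rev_inj) rfl rfl

theorem kroneckerSum_submatrix_flipPerm (ν : ℝ)
    (B : (i : Fin d) → Matrix (Fin (n i)) (Fin (n i)) ℝ) :
    (kroneckerSum ν B).submatrix (flipPerm n) (flipPerm n) =
      kroneckerSum ν fun i => (B i).submatrix Fin.rev Fin.rev := by
  ext p q
  simp only [kroneckerSum, ← inDirection_submatrix_flipPerm, Matrix.submatrix_apply,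
    Matrix.add_apply, Matrix.smul_apply, Matrix.sum_apply, Matrix.one_apply,
    EmbeddingLike.apply_eq_iff_eq]

theorem grunwaldMatrix_submatrix_rev (m : ℕ) (α : ℝ) :
    (grunwaldMatrix m α).submatrix Fin.rev Fin.rev = (grunwaldMatrix m α)ᵀ := by
  ext i j
  simp only [Matrix.submatrix_apply, Matrix.transpose_apply, grunwaldMatrix, Matrix.of_apply,
    Fin.val_rev]
  split_ifs
  · congr 2
    omega
  · omega
  · omega
  · rfl

theorem hankelCorrection_submatrix_rev {m : ℕ} (T : Matrix (Fin m) (Fin m) ℝ) :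
    (hankelCorrection T).submatrix Fin.rev Fin.rev = hankelCorrection T := by
  ext i j
  simp only [Matrix.submatrix_apply, hankelCorrection, Matrix.of_apply, Fin.val_rev]
  rw [add_comm]
  congr 2 <;> omega

theorem tauMatrix_symmPart_grunwaldMatrix_submatrix_rev (m : ℕ) (α : ℝ) :
    (tauMatrix (symmPart (grunwaldMatrix m α))).submatrix Fin.rev Fin.rev =
      tauMatrix (symmPart (grunwaldMatrix m α)) := by
  have hsymm : (symmPart (grunwaldMatrix m α)).submatrix Fin.rev Fin.rev =
      symmPart (grunwaldMatrix m α) := by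
    simp only [symmPart, Matrix.submatrix_smul, Matrix.submatrix_add, Pi.smul_apply, Pi.add_apply,
      ← Matrix.transpose_submatrix, grunwaldMatrix_submatrix_rev, Matrix.transpose_transpose,
      add_comm]
  rw [tauMatrix, Matrix.submatrix_sub, Pi.sub_apply, Pi.sub_apply, hsymm,
    hankelCorrection_submatrix_rev]

end

/-! ### The discretized equation -/

section

variable {d : ℕ} {α dp dm a b : Fin d → ℝ} {τ : ℝ} {n : Fin d → ℕ}

theorem skewBound_nonneg (hdp : ∀ i, 0 ≤ dp i) (hdm : ∀ i, 0 ≤ dm i) : 0 ≤ skewBound α dp dm :=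
  Real.iSup_nonneg fun i =>
    mul_nonneg (div_nonneg (abs_nonneg _) (add_nonneg (hdp i) (hdm i))) (abs_nonneg _)

theorem abs_sub_mul_tan_le (hdp : ∀ i, 0 ≤ dp i) (hdm : ∀ i, 0 ≤ dm i) (i : Fin d) :
    |dp i - dm i| * |Real.tan (α i / 2 * Real.pi)| ≤ skewBound α dp dm * (dp i + dm i) := by
  have hle : |dp i - dm i| / (dp i + dm i) * |Real.tan (α i / 2 * Real.pi)| ≤ skewBound α dp dm :=
    le_ciSup (f := fun i => |dp i - dm i| / (dp i + dm i) * |Real.tan (α i / 2 * Real.pi)|)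
      (Set.finite_range _).bddAbove i
  obtain hzero | hpos := (add_nonneg (hdp i) (hdm i)).eq_or_lt
  · have hdp0 : dp i = 0 := by linarith [hdp i, hdm i]
    have hdm0 : dm i = 0 := by linarith [hdp i, hdm i]
    simp only [hdp0, hdm0, sub_zero, abs_zero, zero_mul, add_zero, mul_zero, le_refl]
  · rwa [div_mul_eq_mul_div, div_le_iff₀ hpos] at hle

/-- The coefficient `c i / h i ^ α i` (for `c = dp` and `c = dm`) with which the Grünwald matrix in
direction `i` and its transpose enter the coefficient matrix. -/
def gridCoeff (α c a b : Fin d → ℝ) (n : Fin d → ℕ) (i : Fin d) : ℝ :=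
  c i / stepSize a b n i ^ α i

theorem stepSize_rpow_pos (hab : ∀ i, a i < b i) (i : Fin d) : 0 < stepSize a b n i ^ α i := by
  have hstep : 0 < stepSize a b n i := div_pos (sub_pos.2 (hab i)) (by positivity)
  positivity

theorem gridCoeff_nonneg {c : Fin d → ℝ} (hc : ∀ i, 0 ≤ c i) (hab : ∀ i, a i < b i) (i : Fin d) :
    0 ≤ gridCoeff α c a b n i :=
  div_nonneg (hc i) (stepSize_rpow_pos hab i).le

theorem abs_gridCoeff_sub_mul_tan_le (hdp : ∀ i, 0 ≤ dp i) (hdm : ∀ i, 0 ≤ dm i)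
    (hab : ∀ i, a i < b i) (i : Fin d) :
    |gridCoeff α dp a b n i - gridCoeff α dm a b n i| * |Real.tan (α i / 2 * Real.pi)| ≤
      skewBound α dp dm * (gridCoeff α dp a b n i + gridCoeff α dm a b n i) := by
  have hpos : 0 < stepSize a b n i ^ α i := stepSize_rpow_pos hab i
  rw [gridCoeff, gridCoeff, ← sub_div, ← add_div, abs_div, abs_of_pos hpos, div_mul_eq_mul_div,
    mul_div_assoc']
  exact div_le_div_of_nonneg_right (abs_sub_mul_tan_le hdp hdm i) hpos.le

theorem coeffMatrix_eq_kroneckerSum :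
    coeffMatrix α dp dm a b τ n = kroneckerSum (1 / τ) fun i =>
      gridCoeff α dp a b n i • grunwaldMatrix (n i) (α i) +
        gridCoeff α dm a b n i • (grunwaldMatrix (n i) (α i))ᵀ := by
  simp only [coeffMatrix, kroneckerSum, gridCoeff, inDirection_add, inDirection_smul,
    inDirection_transpose]

theorem tauPreconditioner_eq_kroneckerSum :
    tauPreconditioner α dp dm a b τ n = kroneckerSum (1 / τ) fun i =>
      (gridCoeff α dp a b n i + gridCoeff α dm a b n i) •
        tauMatrix (symmPart (grunwaldMatrix (n i) (α i))) := by
  simp only [tauPreconditioner, kroneckerSum, gridCoeff, inDirection_smul]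

theorem symmPart_coeffMatrix :
    symmPart (coeffMatrix α dp dm a b τ n) = kroneckerSum (1 / τ) fun i =>
      (gridCoeff α dp a b n i + gridCoeff α dm a b n i) •
        symmPart (grunwaldMatrix (n i) (α i)) := by
  rw [coeffMatrix_eq_kroneckerSum, ← kroneckerSum_symmPart]
  simp only [symmPart_add, symmPart_smul, symmPart_transpose, add_smul]

theorem flipMatrix_mul_coeffMatrix_isSymm (α dp dm a b : Fin d → ℝ) (τ : ℝ) (n : Fin d → ℕ) :
    (flipMatrix n * coeffMatrix α dp dm a b τ n).IsSymm := by
  refine flipMatrix_mul_isSymm ?_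
  rw [coeffMatrix_eq_kroneckerSum, kroneckerSum_submatrix_flipPerm, ← kroneckerSum_transpose]
  simp only [Matrix.submatrix_add, Matrix.submatrix_smul, Pi.add_apply, Pi.smul_apply,
    ← Matrix.transpose_submatrix, grunwaldMatrix_submatrix_rev, Matrix.transpose_add,
    Matrix.transpose_smul]

theorem flipMatrix_mul_tauPreconditioner_mul_flipMatrix :
    flipMatrix n * tauPreconditioner α dp dm a b τ n * flipMatrix n =
      tauPreconditioner α dp dm a b τ n := by
  rw [flipMatrix_mul_mul_flipMatrix, tauPreconditioner_eq_kroneckerSum,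
    kroneckerSum_submatrix_flipPerm]
  simp only [Matrix.submatrix_smul, Pi.smul_apply, tauMatrix_symmPart_grunwaldMatrix_submatrix_rev]

variable (hdp : ∀ i, 0 ≤ dp i) (hdm : ∀ i, 0 ≤ dm i) (hab : ∀ i, a i < b i) (hτ : 0 < τ)

include hdp hdm hab hτ

theorem tauPreconditioner_posDef (hα : ∀ i, α i ∈ Set.Icc (1 : ℝ) 2) :
    (tauPreconditioner α dp dm a b τ n).PosDef := by
  rw [tauPreconditioner_eq_kroneckerSum]
  exact posDef_kroneckerSum (one_div_pos.2 hτ) fun i =>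
    (tauMatrix_symmPart_grunwaldMatrix_posSemidef (hα i) (n i)).smul
      (add_nonneg (gridCoeff_nonneg hdp hab i) (gridCoeff_nonneg hdm hab i))

theorem symmPart_coeffMatrix_posDef (hα : ∀ i, α i ∈ Set.Icc (1 : ℝ) 2) :
    (symmPart (coeffMatrix α dp dm a b τ n)).PosDef := by
  rw [symmPart_coeffMatrix]
  exact posDef_kroneckerSum (one_div_pos.2 hτ) fun i =>
    (symmPart_grunwaldMatrix_posSemidef (hα i) (n i)).smul
      (add_nonneg (gridCoeff_nonneg hdp hab i) (gridCoeff_nonneg hdm hab i))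

theorem symmPart_coeffMatrix_sub_tauPreconditioner_posDef
    (hα : ∀ i, α i ∈ Set.Icc (1 : ℝ) 2) :
    (symmPart (coeffMatrix α dp dm a b τ n) -
      (1 / 2 : ℝ) • tauPreconditioner α dp dm a b τ n).PosDef := by
  rw [symmPart_coeffMatrix, tauPreconditioner_eq_kroneckerSum, kroneckerSum_sub_smul]
  refine posDef_kroneckerSum (by linarith [one_div_pos.2 hτ]) fun i => ?_
  rw [smul_comm, ← smul_sub]
  exact (symmPart_grunwaldMatrix_sub_tauMatrix_posSemidef (hα i) (n i)).smul
    (add_nonneg (gridCoeff_nonneg hdp hab i) (gridCoeff_nonneg hdm hab i))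

theorem tauPreconditioner_sub_symmPart_coeffMatrix_posDef
    (hα : ∀ i, α i ∈ Set.Icc (1 : ℝ) 2) :
    ((6 / 5 : ℝ) • tauPreconditioner α dp dm a b τ n -
      symmPart (coeffMatrix α dp dm a b τ n)).PosDef := by
  rw [symmPart_coeffMatrix, tauPreconditioner_eq_kroneckerSum, ← kroneckerSum_smul,
    ← one_smul ℝ (kroneckerSum (1 / τ) _), kroneckerSum_sub_smul]
  refine posDef_kroneckerSum (by linarith [one_div_pos.2 hτ]) fun i => ?_
  rw [one_smul, smul_comm, ← smul_sub]
  exact (tauMatrix_sub_symmPart_grunwaldMatrix_posSemidef (hα i) (n i)).smul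
    (add_nonneg (gridCoeff_nonneg hdp hab i) (gridCoeff_nonneg hdm hab i))

theorem isSectorial_coeffMatrix (hα : ∀ i, α i ∈ Set.Ioc (1 : ℝ) 2) :
    IsSectorial (skewBound α dp dm) (coeffMatrix α dp dm a b τ n) := by
  rw [coeffMatrix_eq_kroneckerSum]
  exact IsSectorial.kroneckerSum (skewBound_nonneg hdp hdm) (one_div_pos.2 hτ).le fun i =>
    (isSectorial_grunwaldMatrix (hα i) (n i)).smul_add_smul_transpose
      (symmPart_grunwaldMatrix_posSemidef (Set.Ioc_subset_Icc_self (hα i)) (n i))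
      (abs_gridCoeff_sub_mul_tan_le hdp hdm hab i)

theorem abs_mem_Ioo_of_isPencilEigenvalue (hα : ∀ i, α i ∈ Set.Ioc (1 : ℝ) 2) {r : ℝ}
    (hr : IsPencilEigenvalue (flipMatrix n * coeffMatrix α dp dm a b τ n)
      (tauPreconditioner α dp dm a b τ n) r) :
    |r| ∈ Set.Ioo (1 / 2) (6 / 5 * √(1 + skewBound α dp dm ^ 2)) :=
  have hα' := fun i => Set.Ioc_subset_Icc_self (hα i)
  have hP := tauPreconditioner_posDef hdp hdm hab hτ hα'
  ⟨hr.lt_abs_of_flip hP (flipMatrix_isSymm n) (flipMatrix_mul_self n)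
      flipMatrix_mul_tauPreconditioner_mul_flipMatrix
      (symmPart_coeffMatrix_sub_tauPreconditioner_posDef hdp hdm hab hτ hα'),
    hr.abs_lt_of_flip hP (flipMatrix_isSymm n) (flipMatrix_mul_self n)
      flipMatrix_mul_tauPreconditioner_mul_flipMatrix
      (symmPart_coeffMatrix_posDef hdp hdm hab hτ hα')
      (tauPreconditioner_sub_symmPart_coeffMatrix_posDef hdp hdm hab hτ hα')
      (isSectorial_coeffMatrix hdp hdm hab hτ hα)⟩

end

end TauMinres

end

open TauMinres in
theorem mainTheorem10_general (d : ℕ) (α dp dm : Fin d → ℝ)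
    (hα : ∀ i, α i ∈ Set.Ioc (1 : ℝ) 2) (hdp : ∀ i, 0 ≤ dp i) (hdm : ∀ i, 0 ≤ dm i) :
    ∃ ε ω : ℝ,
      0 ≤ ε ∧ ε ≤ skewBound α dp dm ∧
      (0 < skewBound α dp dm → 0 < ε ∧ ε < skewBound α dp dm) ∧
      ω = √((2 + 3 * ε) / (4 + 3 * ε)) ∧
      √(1 / 2) ≤ ω ∧ (0 < skewBound α dp dm → √(1 / 2) < ω) ∧ ω < 1 ∧
      ∀ (a b : Fin d → ℝ) (_ : ∀ i, a i < b i) (τ : ℝ) (_ : 0 < τ)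
        (n : Fin d → ℕ) (A P Y : Matrix (Idx n) (Idx n) ℝ)
        (_ : A = coeffMatrix α dp dm a b τ n)
        (_ : P = tauPreconditioner α dp dm a b τ n)
        (_ : Y = flipMatrix n),
        P.PosDef ∧ (Y * A).IsSymm ∧
        spectrum ℂ ((P⁻¹ * (Y * A)).map (algebraMap ℝ ℂ)) ⊆
          (fun x : ℝ => (x : ℂ)) ''
            (Set.Ioo (-(3 / 2 * (1 + ε))) (-(1 / 2)) ∪ Set.Ioo (1 / 2) (3 / 2 * (1 + ε))) ∧
        ∀ (b' u₀ : Idx n → ℝ) (k : ℕ),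
          (∃! u, IsMinresIterate P (Y * A) (Y.mulVec b') u₀ k u) ∧
          ∀ u, IsMinresIterate P (Y * A) (Y.mulVec b') u₀ k u →
            precNorm P (precResidual P (Y * A) (Y.mulVec b') u) ≤
              2 * ω ^ k *
                precNorm P (precResidual P (Y * A) (Y.mulVec b') u₀) := by
  set μ := skewBound α dp dm
  have hμ : 0 ≤ μ := skewBound_nonneg hdp hdm
  set ε := √(1 + μ ^ 2) - 1 with hε
  have hε0 : 0 ≤ ε := sqrt_one_add_sq_sub_one_nonneg μ
  have hεpos : 0 < μ → 0 < ε := fun h => sqrt_one_add_sq_sub_one_pos h.ne'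
  refine ⟨ε, minresRate ε, hε0, sqrt_one_add_sq_sub_one_le hμ,
    fun h => ⟨hεpos h, sqrt_one_add_sq_sub_one_lt h⟩, rfl, sqrt_half_le_minresRate hε0,
    fun h => sqrt_half_lt_minresRate (hεpos h), minresRate_lt_one hε0, ?_⟩
  rintro a b hab τ hτ n A P Y rfl rfl rfl
  have hP := tauPreconditioner_posDef (n := n) hdp hdm hab hτ fun i =>
    Set.Ioc_subset_Icc_self (hα i)
  have hM := flipMatrix_mul_coeffMatrix_isSymm α dp dm a b τ n
  have hr := fun r => abs_mem_Ioo_of_isPencilEigenvalue (n := n) (r := r) hdp hdm hab hτ hα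
  rw [show √(1 + μ ^ 2) = 1 + ε by rw [hε, add_sub_cancel]] at hr
  have hunit := isUnit_of_not_isPencilEigenvalue_zero fun h => by
    linarith [(hr 0 h).1, abs_zero (α := ℝ)]
  exact ⟨hP, hM,
    spectrum_inv_mul_subset_of_abs_mem_Ioo hP hM fun r h =>
      Set.Ioo_subset_Ioo_right (by linarith) (hr r h),
    fun b' u₀ k => ⟨existsUnique_isMinresIterate hP hunit _ u₀ k, fun u hu =>
      precNorm_precResidual_le_minresRate hP hM hε0 (fun r h => Set.Ioo_subset_Icc_self (hr r h))
        hu⟩⟩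

theorem mainTheorem10 (d : ℕ) (hd : 0 < d) (α dp dm : Fin d → ℝ)
    (hα : ∀ i, α i ∈ Set.Ioo (1 : ℝ) 2) (hdp : ∀ i, 0 ≤ dp i) (hdm : ∀ i, 0 ≤ dm i) :
    ∃ ε ω : ℝ,
      0 ≤ ε ∧ ε ≤ TauMinres.skewBound α dp dm ∧
      (0 < TauMinres.skewBound α dp dm → 0 < ε ∧ ε < TauMinres.skewBound α dp dm) ∧
      ω = √((2 + 3 * ε) / (4 + 3 * ε)) ∧
      √(1 / 2) ≤ ω ∧ (0 < TauMinres.skewBound α dp dm → √(1 / 2) < ω) ∧ ω < 1 ∧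
      ∀ (a b : Fin d → ℝ) (_ : ∀ i, a i < b i) (τ : ℝ) (_ : 0 < τ)
        (n : Fin d → ℕ) (_ : ∀ i, 0 < n i)
        (A P Y : Matrix (TauMinres.Idx n) (TauMinres.Idx n) ℝ)
        (_ : A = TauMinres.coeffMatrix α dp dm a b τ n)
        (_ : P = TauMinres.tauPreconditioner α dp dm a b τ n)
        (_ : Y = TauMinres.flipMatrix n),
        P.PosDef ∧ (Y * A).IsSymm ∧
        spectrum ℂ ((P⁻¹ * (Y * A)).map (algebraMap ℝ ℂ)) ⊆
          (fun x : ℝ => (x : ℂ)) ''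
            (Set.Ioo (-(3 / 2 * (1 + ε))) (-(1 / 2)) ∪ Set.Ioo (1 / 2) (3 / 2 * (1 + ε))) ∧
        ∀ (b' u₀ : TauMinres.Idx n → ℝ) (k : ℕ),
          (∃! u, TauMinres.IsMinresIterate P (Y * A) (Y.mulVec b') u₀ k u) ∧
          ∀ u, TauMinres.IsMinresIterate P (Y * A) (Y.mulVec b') u₀ k u →
            TauMinres.precNorm P (TauMinres.precResidual P (Y * A) (Y.mulVec b') u) ≤
              2 * ω ^ k *
                TauMinres.precNorm P (TauMinres.precResidual P (Y * A) (Y.mulVec b') u₀) := by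
  obtain ⟨ε, ω, hε, hεμ, hpos, hω, hhalf, hhalf', hone, h⟩ :=
    mainTheorem10_general d α dp dm (fun i => Set.Ioo_subset_Ioc_self (hα i)) hdp hdm
  exact ⟨ε, ω, hε, hεμ, hpos, hω, hhalf, hhalf', hone,
    fun a b hab τ hτ n _ => h a b hab τ hτ n⟩
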